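/- **Setting.** Let $w_1,\dots,w_K>0$ with $\sum_j w_j=1$, let $\mu_1,\dots,\mu_K\in\mathbb{R}^d$, and let the data follow the Gaussian mixture $\sum_j w_j\,\mathcal N(\mu_j,I)$. The training set $X$ consists of independent points, $n_j$ of them with label $j$ and law $\mathcal N(\mu_j,I)$; write $x_{j,i}$ for the $i$-th point with label $j$. For $t>0$ put $r_t=e^{-t}$ and $\sigma_t=\sqrt{1-e^{-2t}}$. The denoising network is $\epsilon_\theta(x,y,c)=\sum_{j}\mathbf 1_{y=j}(W_t^j x+V_t^j c)$ with trainable matrices $W_t^j\in\mathbb{R}^{d\times d}$, $V_t^j\in\mathbb{R}^{d\times K}$; let $e_j\in\mathbb{R}^K$ be the one-hot encoding of the label $j$. For a corruption level $\gamma\ge 0$ the network is trained to optimality: for every $t>0$ its parameters minimize $$\sum_{j=1}^K\frac{w_j}{n_j}\sum_{i=1}^{n_j}\mathbb E_{\xi,\epsilon}\big\|\epsilon_\theta(r_tx_{j,i}+\sigma_t\epsilon,\;j,\;e_j+\gamma\xi)-\epsilon\big\|_2^2,\qquad \epsilon\sim\mathcal N(0,I_d),\ \xi\sim\mathcal N(0,I_K)\text{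 independent}$$ (for $n_j=0$ the $j$-th summand is $0$). For a class $k$ with $n_k\ge1$ and a length $T>0$, the generated distribution is the law of $z_T$, where $z_0\sim\mathcal N(0,I_d)$ and $z$ is continuous on $[0,T]$ and solves the reverse ODE $\dot z_s=z_s-\sigma_{T-s}^{-1}\,\epsilon_\theta(z_s,k,e_k)$ on $0\le s<T$, with the parameters taken at time $T-s$. Let $\mathbb P=\mathcal N(\mu_k,I)$, let $\mathbb Q_X$ be the generated distribution of the clean model ($\gamma=0$), and let $\mathbb Q^c_X$ be that of the model trained with corruption level $\gamma$. Let $\mathcal W_2$ be the 2-Wasserstein distance. **Theorem.** For every $B$ there are constants $c_0,\kappa>0$, depending only on $B$, such that the following holds for all $K$, $d$, all mixtures, all sample sizes and every class $k$ with $\|\mu_k\|_2^2\le B$ and $n_k\ge 1$. If $0\le\gamma\le c_0/\sqrt{\max_j n_j}$, then for all sufficiently large $T$ the distributions $\mathbb Q_X$ and $\mathbb Q_X^c$ are well defined (they exist and are unique for every $X$), their 2-Wasserstein distances to $\mathbb P$ are finite for every $X$, the squares of these distances are integrable over the random training set, and $$\mathbb E_X\big[\mathcal W_2^2(\mathbb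 P,\mathbb Q_X)-\mathcal W_2^2(\mathbb P,\mathbb Q_X^c)\big]\;\ge\;\kappa\,\frac{\gamma^2 d}{n_k}.$$ In particular, for $\gamma>0$ and $d\geq 1$ the corruptly trained model is strictly closer to the true class distribution in expected squared 2-Wasserstein distance. -/

import Mathlib

open MeasureTheory ProbabilityTheory Filter
open scoped ENNReal

noncomputable section

/-- Euclidean space `ℝ^d` with its Euclidean norm. -/
abbrev Euc (d : ℕ) : Type := EuclideanSpace ℝ (Fin d)

/-! ### Data -/

/-- The parameters of a Gaussian mixture `∑ k, w k • N(μ k, I)` on `ℝ^d` with `K` classes. -/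
structure GaussianMixture (K d : ℕ) where
  /-- the class weights -/
  w : Fin K → ℝ
  /-- the class means -/
  μ : Fin K → Euc d
  w_pos : ∀ k, 0 < w k
  w_sum : ∑ k, w k = 1

/-- The law `N(μ k, I)` of a data point of class `k`. -/
def GaussianMixture.classLaw {K d : ℕ} (G : GaussianMixture K d) (k : Fin K) : Measure (Euc d) :=
  multivariateGaussian (G.μ k) 1

/-- A labelled data set with `n k` points of class `k`. -/
abbrev Dataset {K : ℕ} (n : Fin K → ℕ) (d : ℕ) : Type := (k : Fin K) → Fin (n k) → Euc d

/-- The law of a random training set: all points independent, those of class `k` distributed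
as `N(μ k, I)`. -/
def GaussianMixture.sampleLaw {K d : ℕ} (G : GaussianMixture K d) (n : Fin K → ℕ) :
    Measure (Dataset n d) :=
  Measure.pi fun k => Measure.pi fun _ : Fin (n k) => G.classLaw k

/-! ### Forward process and denoising network -/

/-- Signal coefficient of the Ornstein-Uhlenbeck forward process,
`x_t = signal t • x + noise t • ε`. -/
def signal (t : ℝ) : ℝ := Real.exp (-t)

/-- Noise coefficient of the Ornstein-Uhlenbeck forward process. -/
def noise (t : ℝ) : ℝ := Real.sqrt (1 - Real.exp (-2 * t))

/-- The one-hot encoding of a label. -/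
def oneHot {K : ℕ} (k : Fin K) : Euc K := EuclideanSpace.single k 1

/-- The parameters (at one time `t`) of the piecewise linear denoising network; for every class a
`d × d` matrix `W k` and a `d × K` matrix `V k`, viewed as linear maps. -/
structure LinearDenoiser (K d : ℕ) where
  W : Fin K → Euc d →L[ℝ] Euc d
  V : Fin K → Euc K →L[ℝ] Euc d

/-- The output `∑ k, 1_{y = k} (W k x + V k c)` of the network at the point `x`, label `y` and
label embedding `c`. -/
def LinearDenoiser.eval {K d : ℕ} (θ : LinearDenoiser K d) (x : Euc d) (y : Fin K) (c : Euc K) :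
    Euc d :=
  ∑ k, if y = k then θ.W k x + θ.V k c else 0

/-- The training loss at time `t` on the data set `X`, when the label embedding `oneHot k` is
replaced by `oneHot k + γ • ξ` with standard Gaussian `ξ`. The clean loss is the case `γ = 0`. -/
def trainingLoss {K d : ℕ} {n : Fin K → ℕ} (w : Fin K → ℝ) (X : Dataset n d) (γ t : ℝ)
    (θ : LinearDenoiser K d) : ℝ :=
  ∑ k, w k / (n k : ℝ) * ∑ i : Fin (n k),
    ∫ ξ, ∫ ε, ‖θ.eval (signal t • X k i + noise t • ε) k (oneHot k + γ • ξ) - ε‖ ^ 2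
      ∂(stdGaussian (Euc d)) ∂(stdGaussian (Euc K))

/-- The network is trained to optimality: at every time `t > 0` its parameters are a global
minimizer of the training loss. -/
def IsTrained {K d : ℕ} {n : Fin K → ℕ} (w : Fin K → ℝ) (X : Dataset n d) (γ : ℝ)
    (θ : ℝ → LinearDenoiser K d) : Prop :=
  ∀ t : ℝ, 0 < t → ∀ θ' : LinearDenoiser K d,
    trainingLoss w X γ t (θ t) ≤ trainingLoss w X γ t θ'

/-! ### Generation -/

/-- The estimate `-ε_θ(x, k) / σ_t` of the conditional score at time `t` given by the network
(evaluated at the uncorrupted embedding of the label `k`). -/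
def scoreEstimate {K d : ℕ} (θ : ℝ → LinearDenoiser K d) (k : Fin K) (t : ℝ) (x : Euc d) : Euc d :=
  -((noise t)⁻¹ • (θ t).eval x k (oneHot k))

/-- `Φ s z` is the value at time `s` of the solution, started at `z`, of the reverse ODE
`dz_s = (z_s + score_{T - s}(z_s)) ds`, `0 ≤ s < T`; the solution is continuous up to the
final time `T`, where the estimated score may be singular. -/
def IsReverseFlow {K d : ℕ} (θ : ℝ → LinearDenoiser K d) (k : Fin K) (T : ℝ)
    (Φ : ℝ → Euc d → Euc d) : Prop :=
  ∀ z : Euc d, Φ 0 z = z ∧ ContinuousOn (fun s => Φ s z) (Set.Icc 0 T) ∧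
    ∀ s ∈ Set.Ico 0 T, HasDerivWithinAt (fun u => Φ u z)
      (Φ s z + scoreEstimate θ k (T - s) (Φ s z)) (Set.Icc 0 T) s

/-- `Q` is the law of the output `z_T` for class `k` of a model trained on `X` with corruption
level `γ`, the reverse ODE being started at `z_0 ∼ N(0, I)`. -/
def IsGenerationLaw {K d : ℕ} {n : Fin K → ℕ} (w : Fin K → ℝ) (X : Dataset n d) (γ : ℝ)
    (k : Fin K) (T : ℝ) (Q : Measure (Euc d)) : Prop :=
  ∃ (θ : ℝ → LinearDenoiser K d) (Φ : ℝ → Euc d → Euc d),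
    IsTrained w X γ θ ∧ IsReverseFlow θ k T Φ ∧ Measurable (Φ T) ∧
      Q = (stdGaussian (Euc d)).map (Φ T)

/-! ### Wasserstein distance -/

/-- The 2-Wasserstein distance between two measures on `ℝ^d`. -/
def wasserstein2 {d : ℕ} (P Q : Measure (Euc d)) : ℝ≥0∞ :=
  (⨅ (π : Measure (Euc d × Euc d)) (_ : π.fst = P ∧ π.snd = Q),
    ∫⁻ p, edist p.1 p.2 ^ 2 ∂π) ^ (1 / 2 : ℝ)

end

/-! Averaging over the label corruption turns it into a ridge penalty `γ ^ 2 * ∑ l, ‖V (oneHot l)‖ ^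
2`, so each class is a least squares problem with an explicit solution. Let m and S be the sample
mean and covariance of class k, and ρ = γ²/(1+γ²). The trained score is exactly that of a Gaussian
with mean (1-ρ)m and covariance S + ρ m mᵀ, pushed along the forward process. The reverse ODE
decouples along the eigenvectors of this covariance, so the generated law is an explicit Gaussian
(`isGenerationLaw_iff`). Its squared distance to N(μ, I) is computed in `wasserstein2_gaussian`: a
mean error plus ∑ (1 - standard deviation)².

As T → ∞ the error of the clean model minus that of the corrupted one becomes ‖μ-m‖² - ‖μ-(1-ρ)m‖² -
ρ‖m‖² + 2 (tr √(S + ρ m mᵀ) - tr √S). With b = ‖μ‖² and q = d/n, the first three terms have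
expectation ρ(1-ρ)q - ρ(1+ρ)b. This suffices when q is large compared with b. Otherwise the term -ρb
has to be cancelled by the trace term. Peierls' inequality and the tangent to the derivative of the
square root at 1 bound the trace difference below by (ρ/4)(3‖m‖² - ⟨m, (S + ρ m mᵀ) m⟩)
(`le_sqrtGain`). Independence of m and the centred points gives this bound an expectation of at
least (ρ/2)(b+q) up to O(ρ²) (`le_integral_sqrtGainBound`). Doubled, it supplies the missing +ρb.

`gain_lower_bound` combines both regimes. Dominated convergence carries the strict inequality from
the limit to all large T. -/

noncomputable section

/-! ### Second moments of the standard Gaussian -/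

section GaussianMoments

variable {E F : Type*} [NormedAddCommGroup E] [InnerProductSpace ℝ E] [FiniteDimensional ℝ E]
  [MeasurableSpace E] [BorelSpace E] [NormedAddCommGroup F] [InnerProductSpace ℝ F]

lemma memLp_add_inner_stdGaussian (α : ℝ) (v : E) :
    MemLp (fun ε => α + inner ℝ v ε) 2 (stdGaussian E) :=
  (memLp_const α).add (IsGaussian.memLp_two_id.const_inner v)

lemma integral_add_inner_sq_stdGaussian (α : ℝ) (v : E) :
    ∫ ε, (α + inner ℝ v ε) ^ 2 ∂(stdGaussian E) = α ^ 2 + ‖v‖ ^ 2 := by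
  have hL : MemLp (fun ε => inner ℝ v ε) 2 (stdGaussian E) :=
    IsGaussian.memLp_two_id.const_inner v
  have h := variance_eq_sub (memLp_add_inner_stdGaussian α v)
  have h1 : Var[fun ε => α + inner ℝ v ε; stdGaussian E] = ‖v‖ ^ 2 := by
    rw [variance_const_add hL.aestronglyMeasurable]
    have := variance_dual_stdGaussian (E := E) (innerSL ℝ v)
    simpa using this
  have h2 : ∫ ε, (α + inner ℝ v ε) ∂(stdGaussian E) = α := by
    rw [integral_add (integrable_const _) (hL.integrable (by norm_num))]
    have := integral_strongDual_stdGaussian (E := E) (innerSL ℝ v)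
    simp only [innerSL_apply_apply] at this
    simp [this]
  simp only [Pi.pow_apply] at h
  rw [h1, h2] at h
  linarith

-- Both sides are the squared Hilbert–Schmidt norm: expand in both bases and exchange the sums.
omit [MeasurableSpace E] [BorelSpace E] in
lemma sum_norm_adjoint_sq [FiniteDimensional ℝ F] {ι κ : Type*} [Fintype ι] [Fintype κ]
    (L : E →L[ℝ] F)
    (b : OrthonormalBasis ι ℝ E) (c : OrthonormalBasis κ ℝ F) :
    ∑ j, ‖ContinuousLinearMap.adjoint L (c j)‖ ^ 2 = ∑ i, ‖L (b i)‖ ^ 2 := by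
  simp_rw [← b.sum_sq_inner_right, ← c.sum_sq_inner_right (L _)]
  rw [Finset.sum_comm]
  refine Finset.sum_congr rfl fun i _ => Finset.sum_congr rfl fun j _ => ?_
  rw [ContinuousLinearMap.adjoint_inner_right, real_inner_comm]

omit [MeasurableSpace E] [BorelSpace E] in
lemma norm_add_apply_sq [FiniteDimensional ℝ F] (a : F) (L : E →L[ℝ] F) (ε : E) :
    ‖a + L ε‖ ^ 2 = ∑ j, (inner ℝ (stdOrthonormalBasis ℝ F j) a +
      inner ℝ (ContinuousLinearMap.adjoint L (stdOrthonormalBasis ℝ F j)) ε) ^ 2 := by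
  rw [← (stdOrthonormalBasis ℝ F).sum_sq_inner_right]
  simp [ContinuousLinearMap.adjoint_inner_left, inner_add_right]

lemma integrable_norm_add_apply_sq [FiniteDimensional ℝ F] (a : F) (L : E →L[ℝ] F) :
    Integrable (fun ε => ‖a + L ε‖ ^ 2) (stdGaussian E) := by
  simp_rw [norm_add_apply_sq]
  exact integrable_finsetSum _ fun j _ => (memLp_add_inner_stdGaussian _ _).integrable_sq

/-- The basis is left free so that it can later be adapted to the data. -/
lemma integral_norm_add_apply_sq [FiniteDimensional ℝ F] {ι : Type*} [Fintype ι]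
    (b : OrthonormalBasis ι ℝ E) (a : F) (L : E →L[ℝ] F) :
    ∫ ε, ‖a + L ε‖ ^ 2 ∂(stdGaussian E) = ‖a‖ ^ 2 + ∑ i, ‖L (b i)‖ ^ 2 := by
  simp_rw [norm_add_apply_sq]
  rw [integral_finsetSum _ fun j _ => (memLp_add_inner_stdGaussian _ _).integrable_sq]
  simp_rw [integral_add_inner_sq_stdGaussian]
  rw [Finset.sum_add_distrib, sum_norm_adjoint_sq L b,
    (stdOrthonormalBasis ℝ F).sum_sq_inner_right]

end GaussianMoments

/-! ### Operators diagonal in an orthonormal basis -/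

/-- The operator with eigenvectors `u i` and eigenvalues `f i`. -/
def specOp {d : ℕ} (u : OrthonormalBasis (Fin d) ℝ (Euc d)) (f : Fin d → ℝ) :
    Euc d →L[ℝ] Euc d :=
  ∑ i, f i • (innerSL ℝ (u i)).smulRight (u i)

section specOp

variable {d : ℕ} (u : OrthonormalBasis (Fin d) ℝ (Euc d)) (f g : Fin d → ℝ)

lemma specOp_apply (v : Euc d) : specOp u f v = ∑ i, (f i * inner ℝ (u i) v) • u i := by
  simp [specOp, smul_smul]

lemma inner_specOp (v : Euc d) (i : Fin d) :
    inner ℝ (u i) (specOp u f v) = f i * inner ℝ (u i) v := by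
  rw [specOp_apply, inner_sum]
  simp_rw [inner_smul_right, u.inner_eq_ite]
  simp

lemma specOp_apply_self (i : Fin d) : specOp u f (u i) = f i • u i := by
  rw [specOp_apply]
  simp_rw [u.inner_eq_ite]
  simp

lemma OrthonormalBasis.ext_inner {v w : Euc d} (h : ∀ i, inner ℝ (u i) v = inner ℝ (u i) w) :
    v = w := by
  rw [← u.sum_repr' v, ← u.sum_repr' w]
  simp_rw [h]

end specOp

/-! ### Sample mean and covariance -/

section Covariance

variable {n d : ℕ}

/-- The mean of the points `x i`. -/
def sampleMean (x : Fin n → Euc d) : Euc d := (n : ℝ)⁻¹ • ∑ i, x i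

/-- The sample covariance operator plus `ρ` times the square of the sample mean. -/
def covOp (ρ : ℝ) (x : Fin n → Euc d) : Euc d →L[ℝ] Euc d :=
  (n : ℝ)⁻¹ • ∑ i, (innerSL ℝ (x i)).smulRight (x i) -
    (1 - ρ) • (innerSL ℝ (sampleMean x)).smulRight (sampleMean x)

lemma covOp_apply (ρ : ℝ) (x : Fin n → Euc d) (v : Euc d) :
    covOp ρ x v = (n : ℝ)⁻¹ • ∑ i, inner ℝ (x i) v • x i -
      ((1 - ρ) * inner ℝ (sampleMean x) v) • sampleMean x := by
  simp [covOp, smul_smul]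

lemma inner_covOp (ρ : ℝ) (x : Fin n → Euc d) (v w : Euc d) :
    inner ℝ v (covOp ρ x w) = (n : ℝ)⁻¹ * ∑ i, inner ℝ (x i) v * inner ℝ (x i) w -
      (1 - ρ) * (inner ℝ (sampleMean x) v * inner ℝ (sampleMean x) w) := by
  rw [covOp_apply, inner_sub_right, inner_smul_right, inner_smul_right, inner_sum]
  simp_rw [inner_smul_right]
  congr 1
  · congr 1
    exact Finset.sum_congr rfl fun i _ => by rw [real_inner_comm v]; ring
  · rw [real_inner_comm v]; ring

lemma covOp_isSymmetric (ρ : ℝ) (x : Fin n → Euc d) :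
    (covOp ρ x : Euc d →ₗ[ℝ] Euc d).IsSymmetric := by
  intro v w
  change inner ℝ (covOp ρ x v) w = inner ℝ v (covOp ρ x w)
  rw [real_inner_comm, inner_covOp, inner_covOp]
  simp_rw [mul_comm]

/-- Eigenvalues of `covOp`. -/
def covEig (ρ : ℝ) (x : Fin n → Euc d) : Fin d → ℝ :=
  (covOp_isSymmetric ρ x).eigenvalues finrank_euclideanSpace_fin

/-- An orthonormal basis of eigenvectors of `covOp`. -/
def covBasis (ρ : ℝ) (x : Fin n → Euc d) : OrthonormalBasis (Fin d) ℝ (Euc d) :=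
  (covOp_isSymmetric ρ x).eigenvectorBasis finrank_euclideanSpace_fin

lemma covOp_covBasis (ρ : ℝ) (x : Fin n → Euc d) (i : Fin d) :
    covOp ρ x (covBasis ρ x i) = covEig ρ x i • covBasis ρ x i :=
  (covOp_isSymmetric ρ x).apply_eigenvectorBasis finrank_euclideanSpace_fin i

lemma card_smul_sampleMean (hn : n ≠ 0) (x : Fin n → Euc d) :
    (n : ℝ) • sampleMean x = ∑ i, x i := by
  rw [sampleMean, smul_smul, mul_inv_cancel₀ (by exact_mod_cast hn), one_smul]

lemma sum_inner_sub_sampleMean_sq (hn : n ≠ 0) (x : Fin n → Euc d) (v : Euc d) :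
    (n : ℝ)⁻¹ * ∑ i, inner ℝ (x i - sampleMean x) v ^ 2 =
      (n : ℝ)⁻¹ * ∑ i, inner ℝ (x i) v ^ 2 - inner ℝ (sampleMean x) v ^ 2 := by
  have hn' : (n : ℝ) ≠ 0 := by exact_mod_cast hn
  have h : ∑ i, inner ℝ (x i) v = n * inner ℝ (sampleMean x) v := by
    rw [← sum_inner, ← card_smul_sampleMean hn, real_inner_smul_left]
  simp_rw [inner_sub_left, sub_sq, Finset.sum_add_distrib, Finset.sum_sub_distrib,
    ← Finset.sum_mul, ← Finset.mul_sum, h]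
  simp
  field_simp
  ring

/-- Centring the points makes the positivity visible that the subtraction in `covOp` hides. -/
lemma inner_covOp_self (hn : n ≠ 0) (ρ : ℝ) (x : Fin n → Euc d) (v : Euc d) :
    inner ℝ v (covOp ρ x v) = (n : ℝ)⁻¹ * ∑ i, inner ℝ (x i - sampleMean x) v ^ 2 +
      ρ * inner ℝ (sampleMean x) v ^ 2 := by
  rw [sum_inner_sub_sampleMean_sq hn, inner_covOp]
  simp_rw [← sq]
  ring

lemma inner_covOp_self_nonneg (hn : n ≠ 0) {ρ : ℝ} (hρ : 0 ≤ ρ) (x : Fin n → Euc d) (v : Euc d) :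
    0 ≤ inner ℝ v (covOp ρ x v) := by
  rw [inner_covOp_self hn]
  positivity

lemma covEig_eq (ρ : ℝ) (x : Fin n → Euc d) (i : Fin d) :
    covEig ρ x i = inner ℝ (covBasis ρ x i) (covOp ρ x (covBasis ρ x i)) := by
  rw [covOp_covBasis, inner_smul_right, real_inner_self_eq_norm_sq, (covBasis ρ x).norm_eq_one]
  simp

lemma covEig_nonneg (hn : n ≠ 0) {ρ : ℝ} (hρ : 0 ≤ ρ) (x : Fin n → Euc d) (i : Fin d) :
    0 ≤ covEig ρ x i := by
  rw [covEig_eq]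
  exact inner_covOp_self_nonneg hn hρ x _

lemma inner_covBasis_covOp (ρ : ℝ) (x : Fin n → Euc d) (i : Fin d) (v : Euc d) :
    inner ℝ (covBasis ρ x i) (covOp ρ x v) = covEig ρ x i * inner ℝ (covBasis ρ x i) v := by
  have := covOp_isSymmetric ρ x (covBasis ρ x i) v
  simp only [ContinuousLinearMap.coe_coe] at this
  rw [← this, covOp_covBasis, real_inner_smul_left]

lemma sum_covEig (ρ : ℝ) (x : Fin n → Euc d) :
    ∑ i, covEig ρ x i = (n : ℝ)⁻¹ * ∑ i, ‖x i‖ ^ 2 - (1 - ρ) * ‖sampleMean x‖ ^ 2 := by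
  simp_rw [covEig_eq, inner_covOp, Finset.sum_sub_distrib, ← Finset.mul_sum, ← sq]
  rw [Finset.sum_comm]
  simp_rw [(covBasis ρ x).sum_sq_inner_left]

end Covariance

/-! ### Training -/

lemma signal_sq (t : ℝ) : signal t ^ 2 = Real.exp (-2 * t) := by
  rw [signal, ← Real.exp_nat_mul]; congr 1; push_cast; ring

lemma exp_neg_two_mul_lt_one {t : ℝ} (ht : 0 < t) : Real.exp (-2 * t) < 1 := by
  rw [Real.exp_lt_one_iff]; linarith

lemma noise_sq {t : ℝ} (ht : 0 < t) : noise t ^ 2 = 1 - Real.exp (-2 * t) :=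
  Real.sq_sqrt (by linarith [exp_neg_two_mul_lt_one ht])

lemma noise_pos {t : ℝ} (ht : 0 < t) : 0 < noise t :=
  Real.sqrt_pos.2 (by linarith [exp_neg_two_mul_lt_one ht])

/-- The variance at time `t` of the forward process whose initial variance is `l`. -/
def forwardVar (t l : ℝ) : ℝ := Real.exp (-2 * t) * l + (1 - Real.exp (-2 * t))

lemma forwardVar_pos {t l : ℝ} (ht : 0 < t) (hl : 0 ≤ l) : 0 < forwardVar t l := by
  have := exp_neg_two_mul_lt_one ht
  have := mul_nonneg (Real.exp_pos (-2 * t)).le hl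
  unfold forwardVar
  linarith

/-- The factor by which training with corruption level `γ` shrinks the sample mean is
`1 - shrinkage γ`. -/
def shrinkage (γ : ℝ) : ℝ := γ ^ 2 / (1 + γ ^ 2)

lemma shrinkage_nonneg (γ : ℝ) : 0 ≤ shrinkage γ := by unfold shrinkage; positivity

lemma shrinkage_zero : shrinkage 0 = 0 := by simp [shrinkage]

lemma one_sub_shrinkage_mul (γ : ℝ) : (1 - shrinkage γ) * (1 + γ ^ 2) = 1 := by
  have : (1 : ℝ) + γ ^ 2 ≠ 0 := by positivity
  unfold shrinkage; field_simp; ring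

lemma LinearDenoiser.eval_eq {K d : ℕ} (θ : LinearDenoiser K d) (x : Euc d) (k : Fin K)
    (c : Euc K) : θ.eval x k c = θ.W k x + θ.V k c := by
  simp [LinearDenoiser.eval]

section ClassLoss

variable {n d K : ℕ}

/-- The sum over the points of one class of the denoising losses, with the Gaussian integrals
evaluated in the orthonormal basis `u`. -/
def classLoss (u : OrthonormalBasis (Fin d) ℝ (Euc d)) (x : Fin n → Euc d) (k : Fin K) (γ t : ℝ)
    (W : Euc d →L[ℝ] Euc d) (V : Euc K →L[ℝ] Euc d) : ℝ :=
  ∑ i, (‖signal t • W (x i) + V (oneHot k)‖ ^ 2 + γ ^ 2 * ∑ l, ‖V (oneHot l)‖ ^ 2 +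
    ∑ j, ‖noise t • W (u j) - u j‖ ^ 2)

/-- Each Gaussian integral contributes a squared Hilbert–Schmidt norm: that of `noise t • W - id`
for the noise, and that of `γ • V` for the corruption, which thus acts as a ridge penalty. -/
lemma integral_pointLoss (u : OrthonormalBasis (Fin d) ℝ (Euc d)) (x : Euc d) (k : Fin K)
    (γ t : ℝ) (W : Euc d →L[ℝ] Euc d) (V : Euc K →L[ℝ] Euc d) :
    ∫ ξ, ∫ ε, ‖W (signal t • x + noise t • ε) + V (oneHot k + γ • ξ) - ε‖ ^ 2
      ∂(stdGaussian (Euc d)) ∂(stdGaussian (Euc K)) =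
    ‖signal t • W x + V (oneHot k)‖ ^ 2 + γ ^ 2 * ∑ l, ‖V (oneHot l)‖ ^ 2 +
      ∑ j, ‖noise t • W (u j) - u j‖ ^ 2 := by
  have h1 : ∀ ξ : Euc K, ∫ ε, ‖W (signal t • x + noise t • ε) + V (oneHot k + γ • ξ) - ε‖ ^ 2
      ∂(stdGaussian (Euc d)) = ‖(signal t • W x + V (oneHot k)) + (γ • V) ξ‖ ^ 2 +
        ∑ j, ‖noise t • W (u j) - u j‖ ^ 2 := by
    intro ξ
    have := integral_norm_add_apply_sq u ((signal t • W x + V (oneHot k)) + (γ • V) ξ)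
      (noise t • W - ContinuousLinearMap.id ℝ (Euc d))
    simp only [sub_apply, smul_apply,
      ContinuousLinearMap.id_apply] at this
    rw [smul_apply, ← this]
    congr 1 with ε
    congr 2
    simp only [map_add, map_smul]
    abel
  simp_rw [h1]
  rw [integral_add (integrable_norm_add_apply_sq _ _) (integrable_const _),
    integral_norm_add_apply_sq (EuclideanSpace.basisFun (Fin K) ℝ)]
  simp [norm_smul, mul_pow, Finset.mul_sum, oneHot]

lemma trainingLoss_eq {n : Fin K → ℕ} (u : Fin K → OrthonormalBasis (Fin d) ℝ (Euc d))
    (w : Fin K → ℝ) (X : Dataset n d) (γ t : ℝ) (θ : LinearDenoiser K d) :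
    trainingLoss w X γ t θ =
      ∑ k, w k / (n k : ℝ) * classLoss (u k) (X k) k γ t (θ.W k) (θ.V k) := by
  rw [trainingLoss]
  refine Finset.sum_congr rfl fun k _ => ?_
  simp_rw [classLoss, LinearDenoiser.eval_eq, integral_pointLoss (u k)]

/-- The optimal matrix acting on the noisy data point. -/
def optW (γ t : ℝ) (x : Fin n → Euc d) : Euc d →L[ℝ] Euc d :=
  specOp (covBasis (shrinkage γ) x)
    fun i => noise t / forwardVar t (covEig (shrinkage γ) x i)

/-- The optimal matrix acting on the label embedding. -/
def optV (γ t : ℝ) (k : Fin K) (x : Fin n → Euc d) : Euc K →L[ℝ] Euc d :=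
  (innerSL ℝ (oneHot k)).smulRight
    (-(signal t * (1 - shrinkage γ)) • optW γ t x (sampleMean x))

lemma inner_oneHot (k l : Fin K) : inner ℝ (oneHot k) (oneHot l) = if k = l then (1 : ℝ) else 0 := by
  simp [oneHot, EuclideanSpace.inner_single_left]

lemma optV_oneHot (γ t : ℝ) (k l : Fin K) (x : Fin n → Euc d) :
    optV γ t k x (oneHot l) = if k = l then
      -(signal t * (1 - shrinkage γ)) • optW γ t x (sampleMean x) else 0 := by
  rw [optV, ContinuousLinearMap.smulRight_apply, innerSL_apply_apply, inner_oneHot]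
  split_ifs <;> simp

lemma norm_add_sq_sum_aux {ι : Type*} [Fintype ι] (a b : ι → Euc d) :
    ∑ i, ‖a i + b i‖ ^ 2 = ∑ i, ‖a i‖ ^ 2 + 2 * ∑ i, inner ℝ (a i) (b i) + ∑ i, ‖b i‖ ^ 2 := by
  simp_rw [norm_add_sq_real, Finset.sum_add_distrib, Finset.mul_sum]

/-- The first order condition for `optW` and `optV`. -/
lemma optimality_condition (hn : n ≠ 0) (γ : ℝ) {t : ℝ} (ht : 0 < t) (k : Fin K)
    (x : Fin n → Euc d) (H : Euc d →L[ℝ] Euc d) (U : Euc K →L[ℝ] Euc d) :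
    ∑ i, inner ℝ (signal t • optW γ t x (x i) + optV γ t k x (oneHot k))
        (signal t • H (x i) + U (oneHot k)) +
      n * γ ^ 2 * ∑ l, inner ℝ (optV γ t k x (oneHot l)) (U (oneHot l)) +
      n * ∑ j, inner ℝ (noise t • optW γ t x (covBasis (shrinkage γ) x j)
        - covBasis (shrinkage γ) x j) (noise t • H (covBasis (shrinkage γ) x j)) = 0 := by
  set ρ := shrinkage γ with hρ
  set u := covBasis ρ x with hu
  set m := sampleMean x with hm
  set A := optW γ t x with hA
  have hn' : (n : ℝ) ≠ 0 := by exact_mod_cast hn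
  have hsumx : ∑ i, x i = (n : ℝ) • m := (card_smul_sampleMean hn x).symm
  have hb : optV γ t k x (oneHot k) = -(signal t * (1 - ρ)) • A m := by
    rw [optV_oneHot, if_pos rfl]
  -- the trace identity
  have htr : ∑ j, inner ℝ (A (covOp ρ x (u j))) (H (u j)) =
      (n : ℝ)⁻¹ * ∑ i, inner ℝ (A (x i)) (H (x i)) - (1 - ρ) * inner ℝ (A m) (H m) := by
    have key : ∀ y : Euc d, ∑ j, inner ℝ y (u j) * inner ℝ (A y) (H (u j)) =
        inner ℝ (A y) (H y) := by
      intro y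
      conv_rhs => rw [show H y = ∑ j, inner ℝ (u j) y • H (u j) by
        simp_rw [← map_smul, ← map_sum, u.sum_repr' y], inner_sum]
      refine Finset.sum_congr rfl fun j _ => ?_
      rw [inner_smul_right, real_inner_comm y]
    rw [← key m]
    simp_rw [← key]
    rw [Finset.sum_comm, Finset.mul_sum, Finset.mul_sum, ← Finset.sum_sub_distrib]
    refine Finset.sum_congr rfl fun j _ => ?_
    rw [covOp_apply, map_sub, map_smul, map_smul, map_sum, inner_sub_left, real_inner_smul_left,
      real_inner_smul_left, sum_inner]
    simp_rw [map_smul, real_inner_smul_left]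
    ring
  -- The normal equation for the matrix part; on an eigenvector it holds because signal² ·
  -- eigenvalue + noise² is `forwardVar`.
  have hAu : ∀ j, signal t ^ 2 • A (covOp ρ x (u j)) + noise t ^ 2 • A (u j) = noise t • u j := by
    intro j
    have hv := forwardVar_pos ht (covEig_nonneg hn (shrinkage_nonneg γ) x j)
    rw [covOp_covBasis, map_smul, hA, optW, specOp_apply_self, signal_sq, noise_sq ht, smul_smul,
      smul_smul, smul_smul, ← add_smul]
    congr 1
    rw [← hρ] at hv ⊢
    rw [← mul_div_assoc, ← mul_div_assoc, ← add_div, div_eq_iff hv.ne']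
    unfold forwardVar
    ring
  have h3 : ∑ j, inner ℝ (noise t • A (u j) - u j) (noise t • H (u j)) =
      -(signal t ^ 2 * ∑ j, inner ℝ (A (covOp ρ x (u j))) (H (u j))) := by
    rw [Finset.mul_sum, ← Finset.sum_neg_distrib]
    refine Finset.sum_congr rfl fun j _ => ?_
    have := congrArg (fun y => inner ℝ y (H (u j))) (hAu j)
    simp only [inner_add_left, real_inner_smul_left] at this
    rw [inner_sub_left, real_inner_smul_left, inner_smul_right, inner_smul_right]
    linear_combination this
  have h2 : ∑ l, inner ℝ (optV γ t k x (oneHot l)) (U (oneHot l)) =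
      -(signal t * (1 - ρ)) * inner ℝ (A m) (U (oneHot k)) := by
    rw [Finset.sum_eq_single k]
    · rw [hb, real_inner_smul_left]
    · intro l _ hl
      rw [optV_oneHot, if_neg (Ne.symm hl), inner_zero_left]
    · simp
  have h1 : ∑ i, inner ℝ (signal t • A (x i) + optV γ t k x (oneHot k))
        (signal t • H (x i) + U (oneHot k)) =
      signal t ^ 2 * ∑ i, inner ℝ (A (x i)) (H (x i)) + signal t * n * inner ℝ (A m) (U (oneHot k))
      - signal t ^ 2 * (1 - ρ) * n * inner ℝ (A m) (H m)
      - signal t * (1 - ρ) * n * inner ℝ (A m) (U (oneHot k)) := by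
    have e1 : ∑ i, inner ℝ (A (x i)) (U (oneHot k)) = n * inner ℝ (A m) (U (oneHot k)) := by
      rw [← sum_inner, ← map_sum, hsumx, map_smul, real_inner_smul_left]
    have e2 : ∑ i, inner ℝ (A m) (H (x i)) = n * inner ℝ (A m) (H m) := by
      rw [← inner_sum, ← map_sum, hsumx, map_smul, inner_smul_right]
    rw [hb]
    simp_rw [inner_add_left, inner_add_right, real_inner_smul_left, inner_smul_right]
    simp_rw [Finset.sum_add_distrib, ← Finset.mul_sum, e1, e2]
    simp
    ring
  rw [h1, h2, h3, htr]
  -- What remains is a multiple of 1 - (1-ρ)(1+γ²); the ridge penalty forces exactly this shrinkage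
  -- of the mean.
  have hγ : (1 - ρ) * (1 + γ ^ 2) = 1 := one_sub_shrinkage_mul γ
  field_simp
  linear_combination (-(n : ℝ) * signal t * inner ℝ (A m) (U (oneHot k))) * hγ

/-- The excess of the class loss over its minimum. -/
lemma classLoss_eq (hn : n ≠ 0) (γ : ℝ) {t : ℝ} (ht : 0 < t) (k : Fin K)
    (x : Fin n → Euc d) (W : Euc d →L[ℝ] Euc d) (V : Euc K →L[ℝ] Euc d) :
    classLoss (covBasis (shrinkage γ) x) x k γ t W V =
      classLoss (covBasis (shrinkage γ) x) x k γ t (optW γ t x) (optV γ t k x) +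
      (∑ i, ‖signal t • (W - optW γ t x) (x i) + (V - optV γ t k x) (oneHot k)‖ ^ 2 +
        n * γ ^ 2 * ∑ l, ‖(V - optV γ t k x) (oneHot l)‖ ^ 2 +
        n * ∑ j, ‖noise t • (W - optW γ t x) (covBasis (shrinkage γ) x j)‖ ^ 2) := by
  have h := optimality_condition hn γ ht k x (W - optW γ t x) (V - optV γ t k x)
  obtain ⟨H, rfl⟩ : ∃ H, W = optW γ t x + H := ⟨W - optW γ t x, by abel⟩
  obtain ⟨U, rfl⟩ : ∃ U, V = optV γ t k x + U := ⟨V - optV γ t k x, by abel⟩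
  simp only [add_sub_cancel_left] at h ⊢
  have e1 : ∀ i, signal t • (optW γ t x + H) (x i) + (optV γ t k x + U) (oneHot k) =
      (signal t • optW γ t x (x i) + optV γ t k x (oneHot k)) +
        (signal t • H (x i) + U (oneHot k)) := by
    intro i; simp only [add_apply, smul_add]; abel
  have e3 : ∀ j, noise t • (optW γ t x + H) (covBasis (shrinkage γ) x j) -
        covBasis (shrinkage γ) x j =
      (noise t • optW γ t x (covBasis (shrinkage γ) x j) - covBasis (shrinkage γ) x j) +
        noise t • H (covBasis (shrinkage γ) x j) := by
    intro i; simp only [add_apply, smul_add]; abel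
  -- The loss is quadratic, so its expansion at the optimum is exact; the cross terms are the first
  -- order condition `h`.
  simp_rw [classLoss, Finset.sum_add_distrib, e1, e3, add_apply,
    norm_add_sq_sum_aux]
  simp
  linear_combination 2 * h

/-- The parameters of a network trained to optimality. -/
def optDenoiser {n : Fin K → ℕ} (γ t : ℝ) (X : Dataset n d) : LinearDenoiser K d where
  W k := optW γ t (X k)
  V k := optV γ t k (X k)

lemma classLoss_opt_le (γ : ℝ) {t : ℝ} (ht : 0 < t) (k : Fin K)
    (x : Fin n → Euc d) (W : Euc d →L[ℝ] Euc d) (V : Euc K →L[ℝ] Euc d) :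
    classLoss (covBasis (shrinkage γ) x) x k γ t (optW γ t x) (optV γ t k x) ≤
      classLoss (covBasis (shrinkage γ) x) x k γ t W V := by
  rcases eq_or_ne n 0 with rfl | hn
  · simp [classLoss]
  · rw [classLoss_eq hn γ ht k x W V]
    have : 0 ≤ (∑ i, ‖signal t • (W - optW γ t x) (x i) + (V - optV γ t k x) (oneHot k)‖ ^ 2 +
        n * γ ^ 2 * ∑ l, ‖(V - optV γ t k x) (oneHot l)‖ ^ 2 +
        n * ∑ j, ‖noise t • (W - optW γ t x) (covBasis (shrinkage γ) x j)‖ ^ 2) := by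
      positivity
    linarith

lemma eq_opt_of_classLoss_le (hn : n ≠ 0) (γ : ℝ) {t : ℝ} (ht : 0 < t) (k : Fin K)
    (x : Fin n → Euc d) (W : Euc d →L[ℝ] Euc d) (V : Euc K →L[ℝ] Euc d)
    (h : classLoss (covBasis (shrinkage γ) x) x k γ t W V ≤
      classLoss (covBasis (shrinkage γ) x) x k γ t (optW γ t x) (optV γ t k x)) :
    W = optW γ t x ∧ V (oneHot k) = optV γ t k x (oneHot k) := by
  rw [classLoss_eq hn γ ht k x W V] at h
  have hn' : (0 : ℝ) < n := by exact_mod_cast Nat.pos_of_ne_zero hn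
  set s1 := ∑ i, ‖signal t • (W - optW γ t x) (x i) + (V - optV γ t k x) (oneHot k)‖ ^ 2 with hs1
  set s2 := n * γ ^ 2 * ∑ l, ‖(V - optV γ t k x) (oneHot l)‖ ^ 2
  set s3 := ∑ j, ‖noise t • (W - optW γ t x) (covBasis (shrinkage γ) x j)‖ ^ 2 with hs3
  have p1 : 0 ≤ s1 := by positivity
  have p2 : 0 ≤ s2 := by positivity
  have p3 : 0 ≤ s3 := by positivity
  have p3' : 0 ≤ n * s3 := by positivity
  have z3 : s3 = 0 := by
    have : n * s3 = 0 := by linarith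
    exact (mul_eq_zero.1 this).resolve_left hn'.ne'
  have z1 : s1 = 0 := by linarith
  -- The noise term alone is definite in the matrix part, since `noise t` is positive and the
  -- operator is tested on a basis.
  have hW : W - optW γ t x = 0 := by
    rw [hs3, Finset.sum_eq_zero_iff_of_nonneg fun _ _ => by positivity] at z3
    have : ((W - optW γ t x : Euc d →L[ℝ] Euc d) : Euc d →ₗ[ℝ] Euc d) = 0 := by
      refine (covBasis (shrinkage γ) x).toBasis.ext fun j => ?_
      have := z3 j (Finset.mem_univ _)
      simpa [(noise_pos ht).ne'] using this
    ext1 v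
    exact LinearMap.congr_fun this v
  refine ⟨sub_eq_zero.1 hW, ?_⟩
  rw [hs1, Finset.sum_eq_zero_iff_of_nonneg fun _ _ => by positivity] at z1
  -- Once the matrix part agrees, a single data point determines the image of the label.
  have := z1 ⟨0, Nat.pos_of_ne_zero hn⟩ (Finset.mem_univ _)
  rw [hW] at this
  simpa [sub_eq_zero] using this

lemma isTrained_optDenoiser {n : Fin K → ℕ} {w : Fin K → ℝ} (hw : ∀ k, 0 < w k)
    (X : Dataset n d) (γ : ℝ) : IsTrained w X γ (fun t => optDenoiser γ t X) := by
  intro t ht θ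
  simp_rw [trainingLoss_eq (fun k => covBasis (shrinkage γ) (X k))]
  exact Finset.sum_le_sum fun k _ => mul_le_mul_of_nonneg_left
    (classLoss_opt_le γ ht k (X k) _ _) (div_nonneg (hw k).le (Nat.cast_nonneg _))

/-- A sum of separately minimizable terms is minimal only if each term is, up to weights that vanish
for empty classes. For γ = 0 the other columns of V are not determined, but generation uses only the
column of the label k. -/
lemma IsTrained.eq_opt {n : Fin K → ℕ} {w : Fin K → ℝ} (hw : ∀ k, 0 < w k)
    {X : Dataset n d} {γ : ℝ} {θ : ℝ → LinearDenoiser K d} (h : IsTrained w X γ θ) {t : ℝ}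
    (ht : 0 < t) (k : Fin K) (hn : n k ≠ 0) :
    (θ t).W k = optW γ t (X k) ∧ (θ t).V k (oneHot k) = optV γ t k (X k) (oneHot k) := by
  have h1 := h t ht (optDenoiser γ t X)
  simp_rw [trainingLoss_eq (fun k => covBasis (shrinkage γ) (X k))] at h1
  have h2 : ∀ j ∈ Finset.univ, w j / (n j : ℝ) *
      classLoss (covBasis (shrinkage γ) (X j)) (X j) j γ t (optW γ t (X j)) (optV γ t j (X j)) ≤
      w j / (n j : ℝ) *
      classLoss (covBasis (shrinkage γ) (X j)) (X j) j γ t ((θ t).W j) ((θ t).V j) :=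
    fun j _ => mul_le_mul_of_nonneg_left
      (classLoss_opt_le γ ht j (X j) _ _) (div_nonneg (hw j).le (Nat.cast_nonneg _))
  have h3 := (Finset.sum_eq_sum_iff_of_le h2).1 (le_antisymm (Finset.sum_le_sum h2) h1) k
    (Finset.mem_univ k)
  have hpos : 0 < w k / (n k : ℝ) :=
    div_pos (hw k) (by exact_mod_cast Nat.pos_of_ne_zero hn)
  exact eq_opt_of_classLoss_le hn γ ht k (X k) _ _ (mul_left_cancel₀ hpos.ne' h3).ge

/-- The score estimate of a trained network. -/
lemma IsTrained.scoreEstimate_eq {n : Fin K → ℕ} {w : Fin K → ℝ} (hw : ∀ k, 0 < w k)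
    {X : Dataset n d} {γ : ℝ} {θ : ℝ → LinearDenoiser K d} (h : IsTrained w X γ θ) {t : ℝ}
    (ht : 0 < t) (k : Fin K) (hn : n k ≠ 0) (z : Euc d) :
    scoreEstimate θ k t z =
      -specOp (covBasis (shrinkage γ) (X k))
        (fun i => (forwardVar t (covEig (shrinkage γ) (X k) i))⁻¹)
        (z - (signal t * (1 - shrinkage γ)) • sampleMean (X k)) := by
  obtain ⟨h1, h2⟩ := h.eq_opt hw ht k hn
  rw [scoreEstimate, LinearDenoiser.eval_eq, h1, h2, optV_oneHot, if_pos rfl, neg_smul,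
    ← sub_eq_add_neg, ← map_smul, ← map_sub]
  congr 1
  refine (covBasis (shrinkage γ) (X k)).ext_inner fun i => ?_
  rw [inner_smul_right, optW, inner_specOp, inner_specOp]
  have := (noise_pos ht).ne'
  field_simp

end ClassLoss

/-! ### The reverse flow -/

lemma forwardVar_zero (l : ℝ) : forwardVar 0 l = l := by simp [forwardVar]

lemma hasDerivAt_forwardVar (T l s : ℝ) :
    HasDerivAt (fun s => forwardVar (T - s) l) (2 * (forwardVar (T - s) l - 1)) s := by
  have h : HasDerivAt (fun s : ℝ => -2 * (T - s)) 2 s := by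
    have := ((hasDerivAt_id s).const_sub T).const_mul (-2)
    simpa using this
  have h2 := (h.exp.mul_const l).add (h.exp.const_sub 1)
  have h3 : (fun s => forwardVar (T - s) l) =
      (fun s => Real.exp (-2 * (T - s)) * l) + fun s => 1 - Real.exp (-2 * (T - s)) := rfl
  rw [h3]
  refine h2.congr_deriv ?_
  unfold forwardVar
  ring

lemma continuous_forwardVar (T l : ℝ) : Continuous fun s => forwardVar (T - s) l := by
  unfold forwardVar; fun_prop

lemma hasDerivAt_sqrt_forwardVar {T l s : ℝ} (hs : s < T) (hl : 0 ≤ l) :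
    HasDerivAt (fun s => √(forwardVar (T - s) l))
      ((1 - (forwardVar (T - s) l)⁻¹) * √(forwardVar (T - s) l)) s := by
  have hv := forwardVar_pos (sub_pos.2 hs) hl
  refine ((hasDerivAt_forwardVar T l s).sqrt hv.ne').congr_deriv ?_
  have h2 := Real.sq_sqrt hv.le
  have h3 := (Real.sqrt_pos.2 hv).ne'
  field_simp
  rw [h2]
  ring

lemma hasDerivAt_signal (T s : ℝ) :
    HasDerivAt (fun s => signal (T - s)) (signal (T - s)) s := by
  have := (((hasDerivAt_id s).const_sub T).neg).exp
  simpa [signal, Function.comp_def] using this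

/-- Solutions of the scalar reverse equation are proportional to the standard deviation of the
forward process. -/
lemma reverse_scalar_unique {T l : ℝ} (hT : 0 < T) (hl : 0 ≤ l) {y : ℝ → ℝ}
    (hc : ContinuousOn y (Set.Icc 0 T))
    (hd : ∀ s ∈ Set.Ico 0 T, HasDerivWithinAt y ((1 - (forwardVar (T - s) l)⁻¹) * y s)
      (Set.Icc 0 T) s) :
    y T = √l / √(forwardVar T l) * y 0 := by
  set g : ℝ → ℝ := fun s => √(forwardVar (T - s) l) with hg
  have hgpos : ∀ s < T, 0 < g s := fun s hs =>
    Real.sqrt_pos.2 (forwardVar_pos (sub_pos.2 hs) hl)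
  have hgc : Continuous g := (continuous_forwardVar T l).sqrt
  -- The quotient y / g has zero derivative. The argument stops before T because g T = √l may vanish
  -- and the equation may be singular there; continuity supplies the endpoint.
  have key : ∀ a ∈ Set.Ico 0 T, y a = g a / g 0 * y 0 := by
    intro a ha
    have hconst : ∀ s ∈ Set.Icc 0 a, y s / g s = y 0 / g 0 := by
      refine constant_of_has_deriv_right_zero ?_ ?_
      · refine ContinuousOn.div (hc.mono (Set.Icc_subset_Icc_right ha.2.le)) hgc.continuousOn ?_
        exact fun s hs => (hgpos s (hs.2.trans_lt ha.2)).ne'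
      · intro s hs
        have hsT : s < T := hs.2.trans ha.2
        have h1 : HasDerivWithinAt y ((1 - (forwardVar (T - s) l)⁻¹) * y s) (Set.Ici s) s := by
          have := hd s ⟨hs.1, hsT⟩
          refine (this.mono (Set.Icc_subset_Icc_left hs.1)).mono_of_mem_nhdsWithin ?_
          exact Icc_mem_nhdsGE hsT
        have h2 := h1.div (hasDerivAt_sqrt_forwardVar hsT hl).hasDerivWithinAt (hgpos s hsT).ne'
        refine h2.congr_deriv ?_
        ring
    have := hconst a ⟨ha.1, le_rfl⟩
    have h0 := (hgpos 0 hT).ne'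
    have h1 := (hgpos a ha.2).ne'
    field_simp at this ⊢
    linarith
  have hlim1 : Tendsto y (nhdsWithin T (Set.Iio T)) (nhds (y T)) := by
    have := hc T ⟨hT.le, le_rfl⟩
    refine tendsto_nhdsWithin_mono_left Set.Ico_subset_Icc_self this |>.mono_left ?_
    rw [nhdsWithin_Ico_eq_nhdsLT hT]
  have hlim2 : Tendsto y (nhdsWithin T (Set.Iio T)) (nhds (g T / g 0 * y 0)) := by
    have h : Tendsto (fun s => g s / g 0 * y 0) (nhdsWithin T (Set.Iio T))
        (nhds (g T / g 0 * y 0)) :=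
      (((hgc.div_const _).mul_const _).tendsto T).mono_left nhdsWithin_le_nhds
    refine h.congr' ?_
    rw [← nhdsWithin_Ico_eq_nhdsLT hT]
    filter_upwards [self_mem_nhdsWithin] with s hs using (key s hs).symm
  have := tendsto_nhds_unique hlim1 hlim2
  simpa [hg, forwardVar_zero] using this

section Flow

variable {n d : ℕ}

/-- The explicit solution of the reverse equation. -/
def reverseFlow (ρ T : ℝ) (x : Fin n → Euc d) (s : ℝ) (z : Euc d) : Euc d :=
  (signal (T - s) * (1 - ρ)) • sampleMean x +
    specOp (covBasis ρ x)
      (fun i => √(forwardVar (T - s) (covEig ρ x i)) / √(forwardVar T (covEig ρ x i)))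
      (z - (signal T * (1 - ρ)) • sampleMean x)

/-- The standard deviation of a generated coordinate along an eigenvector with eigenvalue `l`. -/
def genStd (T l : ℝ) : ℝ := √l / √(forwardVar T l)

/-- The mean of the generated distribution. -/
def genMean (ρ T : ℝ) (x : Fin n → Euc d) : Euc d :=
  (1 - ρ) • sampleMean x - specOp (covBasis ρ x) (fun i => genStd T (covEig ρ x i))
    ((signal T * (1 - ρ)) • sampleMean x)

/-- The map from the initial noise to the generated point. -/
def genMap (ρ T : ℝ) (x : Fin n → Euc d) (z : Euc d) : Euc d :=
  genMean ρ T x + specOp (covBasis ρ x) (fun i => genStd T (covEig ρ x i)) z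

lemma signal_zero : signal 0 = 1 := by simp [signal]

lemma reverseFlow_self (ρ T : ℝ) (x : Fin n → Euc d) : reverseFlow ρ T x T = genMap ρ T x := by
  ext1 z
  simp only [reverseFlow, genMap, genMean, genStd, sub_self, forwardVar_zero, signal_zero, one_mul,
    map_sub]
  abel

lemma reverseFlow_zero (hn : n ≠ 0) {ρ T : ℝ} (hρ : 0 ≤ ρ) (hT : 0 < T) (x : Fin n → Euc d)
    (z : Euc d) : reverseFlow ρ T x 0 z = z := by
  refine (covBasis ρ x).ext_inner fun i => ?_
  rw [reverseFlow, inner_add_right, inner_specOp, sub_zero, div_self, one_mul, ← inner_add_right]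
  · congr 1; abel
  · exact (Real.sqrt_pos.2 (forwardVar_pos hT (covEig_nonneg hn hρ x i))).ne'

lemma continuous_reverseFlow (ρ T : ℝ) (x : Fin n → Euc d) (z : Euc d) :
    Continuous fun s => reverseFlow ρ T x s z := by
  unfold reverseFlow
  simp_rw [specOp_apply]
  refine Continuous.add ?_ (continuous_finsetSum _ fun i _ => ?_)
  · unfold signal; fun_prop
  · exact ((((continuous_forwardVar _ _).sqrt).div_const _).mul_const _).smul continuous_const

/-- The mean part is its own derivative, and along each eigenvector the deviation is a constant
multiple of √`forwardVar`, which solves the scalar equation. -/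
lemma hasDerivAt_reverseFlow (hn : n ≠ 0) {ρ T s : ℝ} (hρ : 0 ≤ ρ) (hs : s < T)
    (x : Fin n → Euc d) (z : Euc d) :
    HasDerivAt (fun s => reverseFlow ρ T x s z)
      (reverseFlow ρ T x s z - specOp (covBasis ρ x)
        (fun i => (forwardVar (T - s) (covEig ρ x i))⁻¹)
        (reverseFlow ρ T x s z - (signal (T - s) * (1 - ρ)) • sampleMean x)) s := by
  set c := z - (signal T * (1 - ρ)) • sampleMean x with hc
  have h1 : HasDerivAt (fun s => (signal (T - s) * (1 - ρ)) • sampleMean x)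
      ((signal (T - s) * (1 - ρ)) • sampleMean x) s :=
    ((hasDerivAt_signal T s).mul_const _).smul_const _
  have h2 : HasDerivAt (fun s => ∑ i, (√(forwardVar (T - s) (covEig ρ x i)) /
      √(forwardVar T (covEig ρ x i)) * inner ℝ (covBasis ρ x i) c) • covBasis ρ x i)
      (∑ i, ((1 - (forwardVar (T - s) (covEig ρ x i))⁻¹) * √(forwardVar (T - s) (covEig ρ x i)) /
      √(forwardVar T (covEig ρ x i)) * inner ℝ (covBasis ρ x i) c) • covBasis ρ x i) s :=
    HasDerivAt.fun_sum fun i _ => (((hasDerivAt_sqrt_forwardVar hs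
      (covEig_nonneg hn hρ x i)).div_const _).mul_const _).smul_const _
  have h3 : (fun s => reverseFlow ρ T x s z) = fun s =>
      (signal (T - s) * (1 - ρ)) • sampleMean x + ∑ i, (√(forwardVar (T - s) (covEig ρ x i)) /
      √(forwardVar T (covEig ρ x i)) * inner ℝ (covBasis ρ x i) c) • covBasis ρ x i := by
    ext1 s; rw [reverseFlow, specOp_apply]
  rw [h3]
  refine (h1.add h2).congr_deriv ?_
  refine (covBasis ρ x).ext_inner fun i => ?_
  rw [← specOp_apply, reverseFlow, ← hc]
  simp only [inner_sub_right, inner_add_right, inner_specOp]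
  ring

/-- After subtraction of the moving mean, projection onto the eigenvectors decouples the ODE into
scalar linear equations. Uniqueness then needs no Lipschitz bound up to the possibly singular final
time. -/
lemma IsReverseFlow.apply_eq {K : ℕ} (hn : n ≠ 0) {ρ T : ℝ} (hρ : 0 ≤ ρ) (hT : 0 < T)
    (x : Fin n → Euc d) {θ : ℝ → LinearDenoiser K d} {k : Fin K}
    (hθ : ∀ t > 0, ∀ z, scoreEstimate θ k t z = -specOp (covBasis ρ x)
        (fun i => (forwardVar t (covEig ρ x i))⁻¹) (z - (signal t * (1 - ρ)) • sampleMean x))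
    {Φ : ℝ → Euc d → Euc d} (hΦ : IsReverseFlow θ k T Φ) : Φ T = genMap ρ T x := by
  ext1 z
  obtain ⟨h0, hc, hd⟩ := hΦ z
  refine (covBasis ρ x).ext_inner fun i => ?_
  have hsig : Continuous fun s => (signal (T - s) * (1 - ρ)) • sampleMean x := by
    unfold signal; fun_prop
  have := reverse_scalar_unique (T := T) (l := covEig ρ x i)
    (y := fun s => innerSL ℝ (covBasis ρ x i)
      (Φ s z - (signal (T - s) * (1 - ρ)) • sampleMean x)) hT (covEig_nonneg hn hρ x i)
    ((innerSL ℝ (covBasis ρ x i)).continuous.comp_continuousOn (hc.sub hsig.continuousOn)) ?_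
  · simp only [innerSL_apply_apply, sub_self, signal_zero, one_mul, sub_zero, h0] at this
    rw [genMap, genMean, inner_add_right, inner_sub_right, inner_specOp, inner_specOp]
    rw [inner_sub_right, inner_sub_right] at this
    unfold genStd
    linarith
  · intro s hs
    have h1 := (hd s hs).sub (((hasDerivAt_signal T s).mul_const (1 - ρ)).smul_const
      (sampleMean x)).hasDerivWithinAt
    have h2 := (innerSL ℝ (covBasis ρ x i)).hasFDerivAt.comp_hasDerivWithinAt s h1
    refine h2.congr_deriv ?_
    rw [hθ _ (sub_pos.2 hs.2)]
    simp only [innerSL_apply_apply]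
    rw [inner_sub_right (covBasis ρ x i) (_ + _), inner_add_right, inner_neg_right, inner_specOp,
      inner_sub_right]
    ring

/-- The generated distributions are exactly the images of the Gaussian under `genMap`. -/
lemma isGenerationLaw_iff {K : ℕ} {n : Fin K → ℕ} {w : Fin K → ℝ} (hw : ∀ k, 0 < w k)
    (X : Dataset n d) (γ : ℝ) (k : Fin K) (hn : n k ≠ 0) {T : ℝ} (hT : 0 < T)
    (Q : Measure (Euc d)) :
    IsGenerationLaw w X γ k T Q ↔
      Q = (stdGaussian (Euc d)).map (genMap (shrinkage γ) T (X k)) := by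
  constructor
  · rintro ⟨θ, Φ, hθ, hΦ, -, rfl⟩
    rw [hΦ.apply_eq hn (shrinkage_nonneg γ) hT (X k)
      fun t ht z => hθ.scoreEstimate_eq hw ht k hn z]
  · rintro rfl
    refine ⟨fun t => optDenoiser γ t X, reverseFlow (shrinkage γ) T (X k),
      isTrained_optDenoiser hw X γ, fun z => ⟨reverseFlow_zero hn (shrinkage_nonneg γ) hT _ _,
        (continuous_reverseFlow _ _ _ _).continuousOn, fun s hs => ?_⟩, ?_, ?_⟩
    · rw [(isTrained_optDenoiser hw X γ).scoreEstimate_eq hw (sub_pos.2 hs.2) k hn,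
        ← sub_eq_add_neg]
      exact (hasDerivAt_reverseFlow hn (shrinkage_nonneg γ) hs.2 _ _).hasDerivWithinAt
    · rw [reverseFlow_self]
      unfold genMap
      fun_prop
    · rw [reverseFlow_self]

end Flow

/-! ### The Wasserstein distance between Gaussians with commuting covariances -/

/-- The integral splits into the squared difference of means and Var(X - Y) = 1 + α² - 2 cov(X, Y),
and Cauchy–Schwarz gives cov(X, Y) ≤ α. -/
lemma sq_sub_add_sq_one_sub_le {Ω : Type*} {mΩ : MeasurableSpace Ω} {π : Measure Ω}
    [IsProbabilityMeasure π] {X Y : Ω → ℝ} (hX : MemLp X 2 π) (hY : MemLp Y 2 π) {α : ℝ}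
    (hα : 0 ≤ α) (hvX : Var[X; π] = 1) (hvY : Var[Y; π] = α ^ 2) :
    (π[X] - π[Y]) ^ 2 + (1 - α) ^ 2 ≤ ∫ ω, (X ω - Y ω) ^ 2 ∂π := by
  have hcov : cov[X, Y; π] ≤ α := by
    have h0 := variance_nonneg (cov[X, Y; π] • X - Y) π
    rw [variance_sub (hX.const_smul _) hY, variance_smul, hvX, hvY, covariance_smul_left] at h0
    exact le_of_sq_le_sq (by nlinarith) hα
  have h1 := variance_sub hX hY
  rw [variance_eq_sub (hX.sub hY), hvX, hvY] at h1
  have h2 : π[X - Y] = π[X] - π[Y] :=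
    integral_sub (hX.integrable (by norm_num)) (hY.integrable (by norm_num))
  rw [h2] at h1
  have h3 : π[(X - Y) ^ 2] = ∫ ω, (X ω - Y ω) ^ 2 ∂π := rfl
  rw [h3] at h1
  nlinarith

lemma multivariateGaussian_one {d : ℕ} (μ : Euc d) :
    multivariateGaussian μ 1 = (stdGaussian (Euc d)).map (fun z => μ + z) := by
  simp [multivariateGaussian]

lemma integral_add_inner_stdGaussian {d : ℕ} (α : ℝ) (v : Euc d) :
    ∫ ε, (α + inner ℝ v ε) ∂(stdGaussian (Euc d)) = α := by
  have hL : MemLp (fun ε => inner ℝ v ε) 2 (stdGaussian (Euc d)) :=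
    IsGaussian.memLp_two_id.const_inner v
  rw [integral_add (integrable_const _) (hL.integrable (by norm_num))]
  have := integral_strongDual_stdGaussian (E := Euc d) (innerSL ℝ v)
  simp only [innerSL_apply_apply] at this
  simp [this]

lemma variance_add_inner_stdGaussian {d : ℕ} (α : ℝ) (v : Euc d) :
    Var[fun ε => α + inner ℝ v ε; stdGaussian (Euc d)] = ‖v‖ ^ 2 := by
  rw [variance_eq_sub (memLp_add_inner_stdGaussian α v), integral_add_inner_stdGaussian]
  simp only [Pi.pow_apply]
  rw [integral_add_inner_sq_stdGaussian]
  ring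

/-- The moments of a coordinate of an affine image of the standard Gaussian, under a measure with
that image as a marginal. -/
lemma marginal_coordinate_moments {Ω : Type*} {mΩ : MeasurableSpace Ω} {π : Measure Ω} {d : ℕ}
    {p : Ω → Euc d} (hp : Measurable p) {F : Euc d → Euc d} (hF : Measurable F)
    (h : π.map p = (stdGaussian (Euc d)).map F) {w v : Euc d} {c : ℝ}
    (hw : ∀ z, inner ℝ w (F z) = c + inner ℝ v z) :
    MemLp (fun ω => inner ℝ w (p ω)) 2 π ∧ ∫ ω, inner ℝ w (p ω) ∂π = c ∧
      Var[fun ω => inner ℝ w (p ω); π] = ‖v‖ ^ 2 := by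
  have hm : Measurable fun z : Euc d => inner ℝ w z := by fun_prop
  have hcomp : (fun z : Euc d => inner ℝ w z) ∘ F = fun z => c + inner ℝ v z := funext hw
  refine ⟨?_, ?_, ?_⟩
  · have h1 : MemLp (fun z : Euc d => inner ℝ w z) 2 (π.map p) := by
      rw [h, memLp_map_measure_iff hm.aestronglyMeasurable hF.aemeasurable, hcomp]
      exact memLp_add_inner_stdGaussian c v
    exact (memLp_map_measure_iff hm.aestronglyMeasurable hp.aemeasurable).1 h1
  · have h1 := integral_map hp.aemeasurable (f := fun z : Euc d => inner ℝ w z)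
      (μ := π) hm.aestronglyMeasurable
    rw [← h1, h, integral_map hF.aemeasurable hm.aestronglyMeasurable]
    simp_rw [hw]
    exact integral_add_inner_stdGaussian c v
  · have h1 := variance_map (μ := π) (Y := p) (X := fun z : Euc d => inner ℝ w z)
      hm.aemeasurable hp.aemeasurable
    change Var[(fun z : Euc d => inner ℝ w z) ∘ p; π] = _
    rw [← h1, h, variance_map hm.aemeasurable hF.aemeasurable, hcomp]
    exact variance_add_inner_stdGaussian c v

/-- The identity covariance is diagonal in every basis, so in the basis `u` the problem reduces to
one-dimensional ones: the coordinatewise lower bounds hold for every coupling, and one coupling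
attains them all. -/
lemma wasserstein2_gaussian {d : ℕ} (μ a : Euc d) (u : OrthonormalBasis (Fin d) ℝ (Euc d))
    {α : Fin d → ℝ} (hα : ∀ i, 0 ≤ α i) :
    wasserstein2 (multivariateGaussian μ 1)
        ((stdGaussian (Euc d)).map fun z => a + specOp u α z) =
      ENNReal.ofReal (‖μ - a‖ ^ 2 + ∑ i, (1 - α i) ^ 2) ^ (1 / 2 : ℝ) := by
  have hF : Measurable fun z => a + specOp u α z := by fun_prop
  have hG : Measurable fun z : Euc d => μ + z := by fun_prop
  rw [multivariateGaussian_one, wasserstein2]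
  congr 1
  refine le_antisymm ?_ ?_
  -- The synchronous coupling: the same noise drives both points.
  · refine (iInf₂_le ((stdGaussian (Euc d)).map fun z => (μ + z, a + specOp u α z)) ?_).trans ?_
    · rw [Measure.fst, Measure.snd, Measure.map_map measurable_fst (hG.prodMk hF),
        Measure.map_map measurable_snd (hG.prodMk hF)]
      exact ⟨rfl, rfl⟩
    · rw [lintegral_map (by fun_prop) (hG.prodMk hF)]
      have h1 : ∀ z : Euc d, edist (μ + z) (a + specOp u α z) ^ 2 = ENNReal.ofReal
          (‖(μ - a) + (ContinuousLinearMap.id ℝ (Euc d) - specOp u α) z‖ ^ 2) := by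
        intro z
        rw [edist_dist, ← ENNReal.ofReal_pow dist_nonneg, dist_eq_norm]
        congr 3
        simp only [sub_apply, ContinuousLinearMap.id_apply]
        abel
      simp_rw [h1]
      rw [← ofReal_integral_eq_lintegral_ofReal (integrable_norm_add_apply_sq _ _)
        (ae_of_all _ fun _ => by positivity), integral_norm_add_apply_sq u]
      refine ENNReal.ofReal_le_ofReal (add_le_add le_rfl (Finset.sum_le_sum fun i _ => ?_))
      rw [sub_apply, specOp_apply_self, ContinuousLinearMap.id_apply]
      have : u i - α i • u i = (1 - α i) • u i := by rw [sub_smul, one_smul]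
      rw [this, norm_smul, u.norm_eq_one, mul_one, Real.norm_eq_abs, sq_abs]
  · refine le_iInf₂ fun π hπ => ?_
    -- The infimum ranges over arbitrary measures; the first marginal forces total mass one.
    have hπp : IsProbabilityMeasure π := by
      have h1 : IsProbabilityMeasure (π.map Prod.fst) := by
        have := hπ.1
        rw [Measure.fst] at this
        rw [this]
        exact Measure.isProbabilityMeasure_map hG.aemeasurable
      exact Measure.isProbabilityMeasure_of_map Prod.fst
    have hX := fun i => marginal_coordinate_moments measurable_fst hG hπ.1 (w := u i) (v := u i)
      (c := inner ℝ (u i) μ) fun z => inner_add_right _ _ _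
    have hY := fun i => marginal_coordinate_moments measurable_snd hF hπ.2 (w := u i)
      (v := α i • u i) (c := inner ℝ (u i) a) fun z => by
        rw [inner_add_right, inner_specOp, real_inner_smul_left]
    have h1 : ∀ p : Euc d × Euc d, edist p.1 p.2 ^ 2 = ENNReal.ofReal
        (∑ i, (inner ℝ (u i) p.1 - inner ℝ (u i) p.2) ^ 2) := by
      intro p
      rw [edist_dist, ← ENNReal.ofReal_pow dist_nonneg, dist_eq_norm, ← u.sum_sq_inner_right]
      simp_rw [inner_sub_right]
    simp_rw [h1]
    have hint : ∀ i, Integrable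
        (fun p : Euc d × Euc d => (inner ℝ (u i) p.1 - inner ℝ (u i) p.2) ^ 2) π :=
      fun i => ((hX i).1.sub (hY i).1).integrable_sq
    rw [← ofReal_integral_eq_lintegral_ofReal (integrable_finsetSum _ fun i _ => hint i)
      (ae_of_all _ fun _ => Finset.sum_nonneg fun _ _ => sq_nonneg _),
      integral_finsetSum _ fun i _ => hint i]
    refine ENNReal.ofReal_le_ofReal ?_
    rw [← u.sum_sq_inner_right, ← Finset.sum_add_distrib]
    refine Finset.sum_le_sum fun i _ => ?_
    have := sq_sub_add_sq_one_sub_le (hX i).1 (hY i).1 (hα i)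
      (by rw [(hX i).2.2, u.norm_eq_one, one_pow])
      (by rw [(hY i).2.2, norm_smul, u.norm_eq_one, mul_one, Real.norm_eq_abs, sq_abs])
    rw [(hX i).2.1, (hY i).2.1] at this
    rwa [inner_sub_right]

/-- The squared distance of the generated distribution from `N(μ, I)`. -/
def genErr {n d : ℕ} (μ : Euc d) (ρ T : ℝ) (x : Fin n → Euc d) : ℝ :=
  ‖μ - genMean ρ T x‖ ^ 2 + ∑ i, (1 - genStd T (covEig ρ x i)) ^ 2

lemma genErr_nonneg {n d : ℕ} (μ : Euc d) (ρ T : ℝ) (x : Fin n → Euc d) :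
    0 ≤ genErr μ ρ T x := by
  unfold genErr; positivity

lemma genStd_nonneg (T l : ℝ) : 0 ≤ genStd T l := by unfold genStd; positivity

lemma wasserstein2_genMap {n d : ℕ} (μ : Euc d) (ρ T : ℝ) (x : Fin n → Euc d) :
    wasserstein2 (multivariateGaussian μ 1) ((stdGaussian (Euc d)).map (genMap ρ T x)) =
      ENNReal.ofReal (genErr μ ρ T x) ^ (1 / 2 : ℝ) :=
  wasserstein2_gaussian μ _ _ fun _ => genStd_nonneg _ _

lemma wasserstein2_genMap_ne_top {n d : ℕ} (μ : Euc d) (ρ T : ℝ) (x : Fin n → Euc d) :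
    wasserstein2 (multivariateGaussian μ 1) ((stdGaussian (Euc d)).map (genMap ρ T x)) ≠ ∞ := by
  rw [wasserstein2_genMap]
  exact ENNReal.rpow_ne_top_of_nonneg (by norm_num) ENNReal.ofReal_ne_top

lemma toReal_wasserstein2_genMap_sq {n d : ℕ} (μ : Euc d) (ρ T : ℝ) (x : Fin n → Euc d) :
    (wasserstein2 (multivariateGaussian μ 1)
      ((stdGaussian (Euc d)).map (genMap ρ T x))).toReal ^ 2 = genErr μ ρ T x := by
  rw [wasserstein2_genMap, ← ENNReal.toReal_rpow, ENNReal.toReal_ofReal (genErr_nonneg _ _ _ _),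
    ← Real.sqrt_eq_rpow, Real.sq_sqrt (genErr_nonneg _ _ _ _)]

/-! ### Comparison of the errors for a fixed training set -/

/-- (3 - l)/4 is the tangent at l = 1 of the convex function 1/(2√l), the derivative of the square
root. A bound linear in l is wanted because its sum over eigenvectors is a quadratic form. -/
lemma mul_three_sub_div_four_le_sqrt_sub_sqrt {l δ : ℝ} (hδ : 0 ≤ δ) (hl : δ ≤ l) :
    δ * (3 - l) / 4 ≤ √l - √(l - δ) := by
  have ha := Real.sq_sqrt (hδ.trans hl)
  have hb := Real.sq_sqrt (sub_nonneg.2 hl)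
  have hba : √(l - δ) ≤ √l := Real.sqrt_le_sqrt (by linarith)
  have hb0 := Real.sqrt_nonneg (l - δ)
  set a := √l
  set b := √(l - δ)
  have h1 : (a + b) * (3 - a ^ 2) ≤ 4 := by
    rcases le_total (3 - a ^ 2) 0 with h | h
    · nlinarith
    -- Here a + b ≤ 2a, and (a-1)²(a+2) ≥ 0 says a(3 - a²) ≤ 2.
    · nlinarith [mul_nonneg (sq_nonneg (a - 1)) (by linarith : 0 ≤ a + 2)]
  have h2 : δ = (a - b) * (a + b) := by nlinarith
  rw [h2, ← ha]
  nlinarith [mul_nonneg (sub_nonneg.2 hba) (sub_nonneg.2 h1)]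

section Pointwise

variable {n d : ℕ}

lemma inner_covOp_eq_add (ρ : ℝ) (x : Fin n → Euc d) (v : Euc d) :
    inner ℝ v (covOp ρ x v) = inner ℝ v (covOp 0 x v) + ρ * inner ℝ (sampleMean x) v ^ 2 := by
  rw [inner_covOp, inner_covOp]; ring

lemma inner_covOp_eq_sum_covEig (ρ : ℝ) (x : Fin n → Euc d) (v : Euc d) :
    inner ℝ v (covOp ρ x v) = ∑ i, covEig ρ x i * inner ℝ (covBasis ρ x i) v ^ 2 := by
  rw [← (covBasis ρ x).sum_inner_mul_inner]
  refine Finset.sum_congr rfl fun i _ => ?_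
  rw [inner_covBasis_covOp, real_inner_comm]
  ring

lemma covEig_sub_eq (ρ : ℝ) (x : Fin n → Euc d) (i : Fin d) :
    covEig ρ x i - ρ * inner ℝ (sampleMean x) (covBasis ρ x i) ^ 2 =
      inner ℝ (covBasis ρ x i) (covOp 0 x (covBasis ρ x i)) := by
  rw [covEig_eq, inner_covOp_eq_add]; ring

/-- Peierls' inequality for the square root. -/
lemma sum_sqrt_covEig_le (hn : n ≠ 0) (x : Fin n → Euc d)
    (u : OrthonormalBasis (Fin d) ℝ (Euc d)) :
    ∑ i, √(covEig 0 x i) ≤ ∑ j, √(inner ℝ (u j) (covOp 0 x (u j))) := by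
  have h1 : ∑ i, √(covEig 0 x i) =
      ∑ j, ∑ i, √(covEig 0 x i) * inner ℝ (covBasis 0 x i) (u j) ^ 2 := by
    rw [Finset.sum_comm]
    refine Finset.sum_congr rfl fun i _ => ?_
    rw [← Finset.mul_sum, u.sum_sq_inner_left, (covBasis 0 x).norm_eq_one, one_pow, mul_one]
  rw [h1]
  refine Finset.sum_le_sum fun j _ => Real.le_sqrt_of_sq_le ?_
  -- Jensen in the form of Cauchy–Schwarz: the weights ⟨eigenvector, u j⟩² sum to one.
  have h2 := Finset.sum_mul_sq_le_sq_mul_sq Finset.univ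
    (fun i => √(covEig 0 x i) * inner ℝ (covBasis 0 x i) (u j))
    (fun i => inner ℝ (covBasis 0 x i) (u j))
  rw [(covBasis 0 x).sum_sq_inner_right, u.norm_eq_one, one_pow, mul_one] at h2
  rw [inner_covOp_eq_sum_covEig]
  calc _ = (∑ i, √(covEig 0 x i) * inner ℝ (covBasis 0 x i) (u j) *
        inner ℝ (covBasis 0 x i) (u j)) ^ 2 := by simp_rw [sq, mul_assoc]
    _ ≤ _ := h2
    _ = _ := by
      refine Finset.sum_congr rfl fun i _ => ?_
      rw [mul_pow, Real.sq_sqrt (covEig_nonneg hn le_rfl x i)]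

/-- The gain in the trace of the square root of the covariance. -/
def sqrtGain (ρ : ℝ) (x : Fin n → Euc d) : ℝ :=
  ∑ i, √(covEig ρ x i) - ∑ i, √(covEig 0 x i)

/-- Peierls' inequality is applied in the eigenbasis of `covOp ρ x`, where `covOp 0 x` has the
diagonal entries under the second root. No perturbation theory of eigenvalues is needed. -/
lemma sum_sqrt_sub_le_sqrtGain (hn : n ≠ 0) (ρ : ℝ) (x : Fin n → Euc d) :
    ∑ i, (√(covEig ρ x i) -
      √(covEig ρ x i - ρ * inner ℝ (sampleMean x) (covBasis ρ x i) ^ 2)) ≤ sqrtGain ρ x := by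
  simp_rw [covEig_sub_eq]
  rw [Finset.sum_sub_distrib, sqrtGain]
  exact sub_le_sub_left (sum_sqrt_covEig_le hn x (covBasis ρ x)) _

lemma sqrtGain_nonneg (hn : n ≠ 0) {ρ : ℝ} (hρ : 0 ≤ ρ) (x : Fin n → Euc d) :
    0 ≤ sqrtGain ρ x := by
  refine (Finset.sum_nonneg fun i _ => ?_).trans (sum_sqrt_sub_le_sqrtGain hn ρ x)
  refine sub_nonneg.2 (Real.sqrt_le_sqrt ?_)
  have : 0 ≤ ρ * inner ℝ (sampleMean x) (covBasis ρ x i) ^ 2 := by positivity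
  linarith

/-- Summing the tangent bound with decrements ρ⟨m, u i⟩² gives (ρ/4)(3‖m‖² - ⟨m, `covOp ρ x` m⟩),
and the quadratic form splits into a centred part and ρ‖m‖⁴. -/
lemma le_sqrtGain (hn : n ≠ 0) {ρ : ℝ} (hρ : 0 ≤ ρ) (x : Fin n → Euc d) :
    ρ / 4 * (3 * ‖sampleMean x‖ ^ 2 -
      (n : ℝ)⁻¹ * ∑ i, inner ℝ (x i - sampleMean x) (sampleMean x) ^ 2 -
      ρ * ‖sampleMean x‖ ^ 4) ≤ sqrtGain ρ x := by
  refine le_trans (le_of_eq ?_) ((Finset.sum_le_sum fun i _ =>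
    mul_three_sub_div_four_le_sqrt_sub_sqrt
      (δ := ρ * inner ℝ (sampleMean x) (covBasis ρ x i) ^ 2) (by positivity) ?_).trans
    (sum_sqrt_sub_le_sqrtGain hn ρ x))
  · have h1 := inner_covOp_self hn ρ x (sampleMean x)
    rw [inner_covOp_eq_sum_covEig, real_inner_self_eq_norm_sq] at h1
    have h2 : (n : ℝ)⁻¹ * ∑ i, inner ℝ (x i - sampleMean x) (sampleMean x) ^ 2 =
      ∑ i, covEig ρ x i * inner ℝ (covBasis ρ x i) (sampleMean x) ^ 2
        - ρ * ‖sampleMean x‖ ^ 4 := by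
      rw [h1]; ring
    rw [h2, ← (covBasis ρ x).sum_sq_inner_left (sampleMean x)]
    rw [sub_sub, sub_add_cancel, Finset.mul_sum, ← Finset.sum_sub_distrib, Finset.mul_sum]
    refine Finset.sum_congr rfl fun i _ => ?_
    rw [real_inner_comm (sampleMean x)]
    ring
  · have := inner_covOp_self_nonneg hn le_rfl x (covBasis ρ x i)
    rw [← covEig_sub_eq] at this
    linarith

/-- The limit of `genErr` as the length of the diffusion tends to infinity. -/
def genErrLim (μ : Euc d) (ρ : ℝ) (x : Fin n → Euc d) : ℝ :=
  ‖μ - (1 - ρ) • sampleMean x‖ ^ 2 + ∑ i, (1 - √(covEig ρ x i)) ^ 2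

lemma genErrLim_eq (hn : n ≠ 0) (μ : Euc d) {ρ : ℝ} (hρ : 0 ≤ ρ) (x : Fin n → Euc d) :
    genErrLim μ ρ x = ‖μ - (1 - ρ) • sampleMean x‖ ^ 2 + d - 2 * ∑ i, √(covEig ρ x i) +
      ((n : ℝ)⁻¹ * ∑ i, ‖x i‖ ^ 2 - (1 - ρ) * ‖sampleMean x‖ ^ 2) := by
  have h : ∀ i, (1 - √(covEig ρ x i)) ^ 2 = 1 - 2 * √(covEig ρ x i) + covEig ρ x i := by
    intro i
    rw [sub_sq, Real.sq_sqrt (covEig_nonneg hn hρ x i)]; ring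
  rw [genErrLim]
  simp_rw [h, Finset.sum_add_distrib, Finset.sum_sub_distrib, ← Finset.mul_sum, sum_covEig]
  simp
  ring

/-- The dimension and the second moments cancel; -ρ‖m‖² is the growth of the trace of the
covariance. -/
lemma genErrLim_zero_sub (hn : n ≠ 0) (μ : Euc d) {ρ : ℝ} (hρ : 0 ≤ ρ) (x : Fin n → Euc d) :
    genErrLim μ 0 x - genErrLim μ ρ x = ‖μ - sampleMean x‖ ^ 2 -
      ‖μ - (1 - ρ) • sampleMean x‖ ^ 2 - ρ * ‖sampleMean x‖ ^ 2 + 2 * sqrtGain ρ x := by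
  rw [genErrLim_eq hn μ le_rfl, genErrLim_eq hn μ hρ, sqrtGain, sub_zero, one_smul]
  ring

/-! ### Convergence and domination of the error as the length grows -/

lemma tendsto_exp_neg_two_mul : Tendsto (fun T : ℝ => Real.exp (-2 * T)) atTop (nhds 0) :=
  Real.tendsto_exp_atBot.comp (tendsto_id.const_mul_atTop_of_neg (by norm_num))

lemma tendsto_signal : Tendsto signal atTop (nhds 0) :=
  Real.tendsto_exp_atBot.comp tendsto_neg_atTop_atBot

lemma tendsto_genStd (l : ℝ) : Tendsto (fun T => genStd T l) atTop (nhds (√l)) := by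
  have h : Tendsto (fun T => forwardVar T l) atTop (nhds (0 * l + (1 - 0))) :=
    (tendsto_exp_neg_two_mul.mul_const l).add (tendsto_exp_neg_two_mul.const_sub 1)
  rw [zero_mul, zero_add, sub_zero] at h
  have h2 := (tendsto_const_nhds (x := √l)).div h.sqrt (by simp)
  rw [Real.sqrt_one, div_one] at h2
  exact h2

lemma tendsto_genErr (μ : Euc d) (ρ : ℝ) (x : Fin n → Euc d) :
    Tendsto (fun T => genErr μ ρ T x) atTop (nhds (genErrLim μ ρ x)) := by
  have h1 : Tendsto (fun T => genMean ρ T x) atTop (nhds ((1 - ρ) • sampleMean x)) := by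
    have h2 : Tendsto (fun T => ∑ i, (genStd T (covEig ρ x i) * (signal T * ((1 - ρ) *
        inner ℝ (covBasis ρ x i) (sampleMean x)))) • covBasis ρ x i) atTop
        (nhds (∑ i, (√(covEig ρ x i) * (0 * ((1 - ρ) *
          inner ℝ (covBasis ρ x i) (sampleMean x)))) • covBasis ρ x i)) :=
      tendsto_finsetSum _ fun i _ => ((tendsto_genStd _).mul
        (tendsto_signal.mul_const _)).smul_const _
    have h3 := h2.const_sub ((1 - ρ) • sampleMean x)
    simp only [zero_mul, mul_zero, zero_smul, Finset.sum_const_zero, sub_zero] at h3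
    refine h3.congr fun T => ?_
    rw [genMean, specOp_apply]
    simp_rw [inner_smul_right, mul_assoc]
  exact ((h1.const_sub μ).norm.pow 2).add
    (tendsto_finsetSum _ fun i _ => ((tendsto_genStd _).const_sub 1).pow 2)

lemma genStd_mul_signal_le_one {T l : ℝ} (hT : 0 < T) (hl : 0 ≤ l) :
    genStd T l * signal T ≤ 1 := by
  have hv := forwardVar_pos hT hl
  have hs : signal T = √(Real.exp (-2 * T)) := by
    rw [← signal_sq, Real.sqrt_sq (show 0 ≤ signal T from (Real.exp_pos _).le)]
  rw [genStd, div_mul_eq_mul_div, div_le_one (Real.sqrt_pos.2 hv), hs, ← Real.sqrt_mul hl]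
  refine Real.sqrt_le_sqrt ?_
  have := exp_neg_two_mul_lt_one hT
  unfold forwardVar
  nlinarith

/-- The factor 2 comes from e^(-2T) ≤ 1/2, hence `forwardVar T l` ≥ 1/2, once T ≥ 1. -/
lemma genStd_sq_le {T l : ℝ} (hT : 1 ≤ T) (hl : 0 ≤ l) : genStd T l ^ 2 ≤ 2 * l := by
  have hv := forwardVar_pos (by linarith : 0 < T) hl
  rw [genStd, div_pow, Real.sq_sqrt hl, Real.sq_sqrt hv.le, div_le_iff₀ hv]
  have h1 : Real.exp (-2 * T) ≤ 1 / 2 := by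
    have : Real.exp (-2 * T) ≤ Real.exp (-2) := Real.exp_le_exp.2 (by linarith)
    have h2 : Real.exp (-2) * Real.exp 2 = 1 := by rw [← Real.exp_add]; simp
    nlinarith [Real.add_one_le_exp (2 : ℝ), Real.exp_pos (-2)]
  have h2 : 1 / 2 ≤ forwardVar T l := by
    have := mul_nonneg (Real.exp_pos (-2 * T)).le hl
    unfold forwardVar
    linarith
  nlinarith

/-- In the eigenbasis, each coordinate of the sample mean is multiplied by a factor in [0, 1]. -/
lemma norm_genMean_le (hn : n ≠ 0) {ρ T : ℝ} (hρ : 0 ≤ ρ) (hρ1 : ρ ≤ 1) (hT : 0 < T)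
    (x : Fin n → Euc d) : ‖genMean ρ T x‖ ^ 2 ≤ ‖sampleMean x‖ ^ 2 := by
  rw [← (covBasis ρ x).sum_sq_inner_right, ← (covBasis ρ x).sum_sq_inner_right (sampleMean x)]
  refine Finset.sum_le_sum fun i _ => ?_
  have h1 := genStd_mul_signal_le_one hT (covEig_nonneg hn hρ x i)
  have h2 : 0 ≤ genStd T (covEig ρ x i) * signal T :=
    mul_nonneg (genStd_nonneg _ _) (Real.exp_pos _).le
  have h3 : inner ℝ (covBasis ρ x i) (genMean ρ T x) =
      ((1 - ρ) * (1 - genStd T (covEig ρ x i) * signal T)) *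
        inner ℝ (covBasis ρ x i) (sampleMean x) := by
    rw [genMean, inner_sub_right, inner_specOp, inner_smul_right, inner_smul_right]
    ring
  rw [h3, mul_pow]
  refine mul_le_of_le_one_left (sq_nonneg _) (pow_le_one₀ ?_ ?_)
  · exact mul_nonneg (by linarith) (by linarith)
  · exact mul_le_one₀ (by linarith) (by linarith) (by linarith)

lemma genErr_le (hn : n ≠ 0) (μ : Euc d) {ρ T : ℝ} (hρ : 0 ≤ ρ) (hρ1 : ρ ≤ 1) (hT : 1 ≤ T)
    (x : Fin n → Euc d) :
    genErr μ ρ T x ≤ 2 * ‖μ‖ ^ 2 + 2 * ‖sampleMean x‖ ^ 2 + 2 * d +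
      4 * ((n : ℝ)⁻¹ * ∑ i, ‖x i‖ ^ 2) := by
  have h1 := norm_genMean_le hn hρ hρ1 (by linarith : 0 < T) x
  have h2 : ‖μ - genMean ρ T x‖ ^ 2 ≤ 2 * ‖μ‖ ^ 2 + 2 * ‖genMean ρ T x‖ ^ 2 := by
    have := norm_sub_le μ (genMean ρ T x)
    nlinarith [norm_nonneg (μ - genMean ρ T x), sq_nonneg (‖μ‖ - ‖genMean ρ T x‖)]
  have h3 : ∑ i, (1 - genStd T (covEig ρ x i)) ^ 2 ≤ ∑ i, (2 + 4 * covEig ρ x i) := by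
    refine Finset.sum_le_sum fun i _ => ?_
    have := genStd_sq_le hT (covEig_nonneg hn hρ x i)
    nlinarith [sq_nonneg (1 + genStd T (covEig ρ x i))]
  rw [Finset.sum_add_distrib, ← Finset.mul_sum, sum_covEig] at h3
  simp at h3
  have h4 : 0 ≤ (1 - ρ) * ‖sampleMean x‖ ^ 2 := mul_nonneg (by linarith) (sq_nonneg _)
  rw [genErr]
  linarith

end Pointwise

/-! ### Measurability of spectral functions of the sample covariance -/

section Measurability

variable {n d : ℕ}

@[fun_prop]
lemma continuous_sampleMean : Continuous (sampleMean : (Fin n → Euc d) → Euc d) := by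
  unfold sampleMean; fun_prop

/-- The sum is ⟨v, (`covOp`)^j w⟩, hence independent of the chosen eigenbasis, which itself need not
vary continuously with the data. -/
lemma continuous_sum_covEig_pow (ρ : ℝ) (j : ℕ) {v w : (Fin n → Euc d) → Euc d}
    (hv : Continuous v) (hw : Continuous w) :
    Continuous fun x => ∑ i, covEig ρ x i ^ j *
      (inner ℝ (covBasis ρ x i) (v x) * inner ℝ (covBasis ρ x i) (w x)) := by
  induction j generalizing w with
  | zero =>
    have : (fun x => ∑ i, covEig ρ x i ^ 0 *
        (inner ℝ (covBasis ρ x i) (v x) * inner ℝ (covBasis ρ x i) (w x))) =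
        fun x => inner ℝ (v x) (w x) := by
      ext1 x
      rw [← (covBasis ρ x).sum_inner_mul_inner]
      simp_rw [pow_zero, one_mul, real_inner_comm (v x)]
    rw [this]
    exact hv.inner hw
  | succ j ih =>
    have hw' : Continuous fun x => covOp ρ x (w x) := by
      simp_rw [covOp_apply]
      fun_prop
    refine (ih hw').congr fun x => Finset.sum_congr rfl fun i _ => ?_
    rw [inner_covBasis_covOp]
    ring

/-- Weierstrass approximation on [-N, N] makes the matrix coefficient of f(`covOp`) a pointwise
limit of the polynomial ones, which are continuous. -/
lemma measurable_sum_covEig (ρ : ℝ) {f : ℝ → ℝ} (hf : Continuous f)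
    {v w : (Fin n → Euc d) → Euc d} (hv : Continuous v) (hw : Continuous w) :
    Measurable fun x => ∑ i, f (covEig ρ x i) *
      (inner ℝ (covBasis ρ x i) (v x) * inner ℝ (covBasis ρ x i) (w x)) := by
  choose p hp using fun N : ℕ => exists_polynomial_near_of_continuousOn (-(N : ℝ)) N f
    hf.continuousOn (1 / ((N : ℝ) + 1)) (by positivity)
  have hlim : ∀ l : ℝ, Tendsto (fun N => (p N).eval l) atTop (nhds (f l)) := by
    intro l
    rw [tendsto_iff_dist_tendsto_zero]
    refine squeeze_zero' (Eventually.of_forall fun _ => dist_nonneg) ?_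
      tendsto_one_div_add_atTop_nhds_zero_nat
    obtain ⟨N₀, hN₀⟩ := exists_nat_ge |l|
    filter_upwards [eventually_ge_atTop N₀] with N hN
    have h1 : |l| ≤ N := hN₀.trans (by exact_mod_cast hN)
    rw [Real.dist_eq]
    exact (hp N l ⟨(abs_le.1 h1).1, (abs_le.1 h1).2⟩).le
  refine measurable_of_tendsto_metrizable (f := fun N x => ∑ i, (p N).eval (covEig ρ x i) *
      (inner ℝ (covBasis ρ x i) (v x) * inner ℝ (covBasis ρ x i) (w x))) (fun N => ?_) ?_
  · refine Continuous.measurable ?_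
    have : (fun x => ∑ i, (p N).eval (covEig ρ x i) *
        (inner ℝ (covBasis ρ x i) (v x) * inner ℝ (covBasis ρ x i) (w x))) =
        fun x => ∑ j ∈ Finset.range ((p N).natDegree + 1), (p N).coeff j *
          ∑ i, covEig ρ x i ^ j *
            (inner ℝ (covBasis ρ x i) (v x) * inner ℝ (covBasis ρ x i) (w x)) := by
      ext1 x
      simp_rw [Polynomial.eval_eq_sum_range, Finset.sum_mul, Finset.mul_sum, mul_assoc]
      exact Finset.sum_comm
    rw [this]
    exact continuous_finsetSum _ fun j _ =>
      continuous_const.mul (continuous_sum_covEig_pow ρ j hv hw)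
  · exact tendsto_pi_nhds.2 fun x => tendsto_finsetSum _ fun i _ => (hlim _).mul_const _

lemma measurable_trace_covEig (ρ : ℝ) {f : ℝ → ℝ} (hf : Continuous f) :
    Measurable fun x : Fin n → Euc d => ∑ i, f (covEig ρ x i) := by
  have : (fun x : Fin n → Euc d => ∑ i, f (covEig ρ x i)) = fun x => ∑ j, ∑ i,
      f (covEig ρ x i) * (inner ℝ (covBasis ρ x i) (EuclideanSpace.basisFun (Fin d) ℝ j) *
        inner ℝ (covBasis ρ x i) (EuclideanSpace.basisFun (Fin d) ℝ j)) := by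
    ext1 x
    rw [Finset.sum_comm]
    refine Finset.sum_congr rfl fun i _ => ?_
    rw [← Finset.mul_sum]
    simp_rw [← sq]
    rw [(EuclideanSpace.basisFun (Fin d) ℝ).sum_sq_inner_left, (covBasis ρ x).norm_eq_one,
      one_pow, mul_one]
  rw [this]
  exact Finset.measurable_fun_sum _ fun j _ =>
    measurable_sum_covEig ρ hf continuous_const continuous_const

lemma continuous_genStd {T : ℝ} (hT : 0 < T) : Continuous (genStd T) := by
  -- Truncating at 0 keeps the denominator positive; for negative l the numerator √l is 0 anyway.
  have h : genStd T = fun l => √l / √(forwardVar T (max l 0)) := by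
    ext1 l
    rcases le_total l 0 with hl | hl
    · rw [genStd, Real.sqrt_eq_zero_of_nonpos hl, zero_div, zero_div]
    · rw [genStd, max_eq_left hl]
  rw [h]
  refine Real.continuous_sqrt.div ?_ fun l =>
    (Real.sqrt_pos.2 (forwardVar_pos hT (le_max_right _ _))).ne'
  unfold forwardVar
  fun_prop

lemma measurable_genMean (ρ : ℝ) {T : ℝ} (hT : 0 < T) :
    Measurable (genMean ρ T : (Fin n → Euc d) → Euc d) := by
  have h : (genMean ρ T : (Fin n → Euc d) → Euc d) = fun x => (1 - ρ) • sampleMean x -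
      ∑ j, (∑ i, genStd T (covEig ρ x i) * (inner ℝ (covBasis ρ x i)
        ((signal T * (1 - ρ)) • sampleMean x) *
        inner ℝ (covBasis ρ x i) (EuclideanSpace.basisFun (Fin d) ℝ j))) •
          EuclideanSpace.basisFun (Fin d) ℝ j := by
    ext1 x
    rw [genMean]
    congr 1
    conv_lhs => rw [← (EuclideanSpace.basisFun (Fin d) ℝ).sum_repr' (specOp _ _ _)]
    refine Finset.sum_congr rfl fun j _ => ?_
    rw [specOp_apply, inner_sum]
    congr 1
    refine Finset.sum_congr rfl fun i _ => ?_
    rw [inner_smul_right, real_inner_comm (covBasis ρ x i), mul_assoc]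
  rw [h]
  refine Measurable.sub (by fun_prop) (Finset.measurable_fun_sum _ fun j _ => ?_)
  exact (measurable_sum_covEig ρ (continuous_genStd hT) (by fun_prop)
    continuous_const).smul_const _

lemma measurable_genErr (μ : Euc d) (ρ : ℝ) {T : ℝ} (hT : 0 < T) :
    Measurable (genErr μ ρ T : (Fin n → Euc d) → ℝ) := by
  unfold genErr
  refine Measurable.add ?_ (measurable_trace_covEig ρ (f := fun l => (1 - genStd T l) ^ 2) ?_)
  · exact ((measurable_const.sub (measurable_genMean ρ hT)).norm).pow_const 2
  · exact (continuous_const.sub (continuous_genStd hT)).pow 2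

end Measurability

/-! ### Moments of Gaussian samples -/

lemma integrable_of_abs_le_pow {E : Type*} [NormedAddCommGroup E] [NormedSpace ℝ E]
    [MeasurableSpace E] [BorelSpace E] [CompleteSpace E] [SecondCountableTopology E]
    (P : Measure E) [IsGaussian P] {f : E → ℝ} (hf : AEStronglyMeasurable f P) (C : ℝ)
    (h : ∀ x, |f x| ≤ C * (1 + ‖x‖) ^ 4) : Integrable f P := by
  have hb : MemLp (fun x : E => ‖x‖) 4 P :=
    (IsGaussian.memLp_id P 4 ENNReal.ofNat_ne_top).norm
  have ha : MemLp (fun _ : E => (1 : ℝ)) 4 P := memLp_const 1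
  have h1 : MemLp (fun x : E => 1 + ‖x‖) 4 P := ha.add hb
  have h2 := h1.integrable_norm_pow (p := 4) (by norm_num)
  refine (h2.const_mul C).mono' hf (ae_of_all _ fun x => ?_)
  rw [Real.norm_eq_abs, Real.norm_eq_abs, abs_of_nonneg (by positivity : 0 ≤ 1 + ‖x‖)]
  exact h x

section StdGaussian

variable {d : ℕ}

lemma map_inner_stdGaussian {v : Euc d} (hv : ‖v‖ = 1) :
    (stdGaussian (Euc d)).map (fun z => inner ℝ v z) = gaussianReal 0 1 := by
  have h := IsGaussian.map_eq_gaussianReal (μ := stdGaussian (Euc d)) (innerSL ℝ v)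
  rw [integral_strongDual_stdGaussian, variance_dual_stdGaussian, innerSL_apply_norm, hv] at h
  simpa using h

/-- The fourth moment of the standard Gaussian on the line. -/
def gaussianFourthMoment : ℝ := ∫ x, x ^ 4 ∂(gaussianReal 0 1)

lemma gaussianFourthMoment_nonneg : 0 ≤ gaussianFourthMoment :=
  integral_nonneg fun _ => by positivity

lemma integral_inner_pow_four {v : Euc d} (hv : ‖v‖ = 1) :
    ∫ z, inner ℝ v z ^ 4 ∂(stdGaussian (Euc d)) = gaussianFourthMoment := by
  rw [gaussianFourthMoment, ← map_inner_stdGaussian hv, integral_map (by fun_prop) (by fun_prop)]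

lemma integral_norm_pow_four_le :
    ∫ z, ‖z‖ ^ 4 ∂(stdGaussian (Euc d)) ≤ d ^ 2 * gaussianFourthMoment := by
  set b := EuclideanSpace.basisFun (Fin d) ℝ
  have hpt : ∀ z : Euc d, ‖z‖ ^ 4 ≤ d * ∑ i, inner ℝ (b i) z ^ 4 := by
    intro z
    have h1 := sq_sum_le_card_mul_sum_sq (s := Finset.univ) (f := fun i => inner ℝ (b i) z ^ 2)
    rw [b.sum_sq_inner_right, ← pow_mul] at h1
    simpa [← pow_mul] using h1
  have hint : ∀ i, Integrable (fun z => inner ℝ (b i) z ^ 4) (stdGaussian (Euc d)) := by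
    intro i
    refine integrable_of_abs_le_pow _ (Continuous.aestronglyMeasurable (by fun_prop)) 1
      fun z => ?_
    rw [abs_pow, one_mul]
    have h1 := abs_real_inner_le_norm (b i) z
    rw [b.norm_eq_one, one_mul] at h1
    gcongr
    linarith
  calc _ ≤ ∫ z, (d : ℝ) * ∑ i, inner ℝ (b i) z ^ 4 ∂(stdGaussian (Euc d)) := by
        refine integral_mono (integrable_of_abs_le_pow _
          (Continuous.aestronglyMeasurable (by fun_prop)) 1 fun z => ?_)
          ((integrable_finsetSum _ fun i _ => hint i).const_mul _) hpt
        rw [abs_of_nonneg (by positivity), one_mul]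
        gcongr
        linarith
    _ = _ := by
        rw [integral_const_mul, integral_finsetSum _ fun i _ => hint i]
        simp_rw [integral_inner_pow_four (b.norm_eq_one _)]
        simp
        ring

end StdGaussian

section Sample

variable {n d : ℕ}

/-- The law of `n` independent points of law `N(μ, I)`. -/
abbrev gaussianSample (n : ℕ) {d : ℕ} (μ : Euc d) : Measure (Fin n → Euc d) :=
  Measure.pi fun _ => multivariateGaussian μ 1

lemma hasGaussianLaw_gaussianSample (μ : Euc d) :
    HasGaussianLaw (fun (x : Fin n → Euc d) i => x i) (gaussianSample n μ) := by
  refine iIndepFun.hasGaussianLaw (X := fun i (x : Fin n → Euc d) => x i) (fun i => ?_)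
    (iIndepFun_pi (X := fun _ => id) fun _ => aemeasurable_id)
  have : IsGaussian ((gaussianSample n μ).map fun x => x i) := by
    rw [(measurePreserving_eval (fun _ : Fin n => multivariateGaussian μ 1) i).map_eq]
    infer_instance
  exact IsGaussian.hasGaussianLaw

instance isGaussian_gaussianSample (μ : Euc d) : IsGaussian (gaussianSample n μ) := by
  have := (hasGaussianLaw_gaussianSample (n := n) μ).isGaussian_map
  rwa [show (fun (x : Fin n → Euc d) i => x i) = id from rfl, Measure.map_id] at this

lemma memLp_inner_eval (μ a : Euc d) (i : Fin n) :
    MemLp (fun x : Fin n → Euc d => inner ℝ a (x i)) 2 (gaussianSample n μ) :=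
  ((hasGaussianLaw_gaussianSample μ).eval i).memLp_two.const_inner a

lemma integral_inner_eval (μ a : Euc d) (i : Fin n) :
    ∫ x, inner ℝ a (x i) ∂(gaussianSample n μ) = inner ℝ a μ := by
  have h := integral_comp_eval (μ := fun _ : Fin n => multivariateGaussian μ 1) (i := i)
    (f := fun y => inner ℝ a y) (Continuous.aestronglyMeasurable (by fun_prop))
  rw [h, integral_inner IsGaussian.integrable_fun_id, integral_id_multivariateGaussian]

lemma covariance_inner_eval (μ a b : Euc d) (i j : Fin n) :
    cov[fun x : Fin n → Euc d => inner ℝ a (x i), fun x => inner ℝ b (x j);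
      gaussianSample n μ] = if i = j then inner ℝ a b else 0 := by
  split_ifs with h
  · subst h
    have h1 := covariance_map_fun (μ := gaussianSample n μ) (Z := fun x : Fin n → Euc d => x i)
      (X := fun y => inner ℝ a y) (Y := fun y => inner ℝ b y)
      (Continuous.aestronglyMeasurable (by fun_prop))
      (Continuous.aestronglyMeasurable (by fun_prop)) (measurable_pi_apply i).aemeasurable
    rw [← h1, (measurePreserving_eval (fun _ : Fin n => multivariateGaussian μ 1) i).map_eq,
      ← covarianceBilin_apply_eq_cov IsGaussian.memLp_two_id,
      covarianceBilin_multivariateGaussian Matrix.PosSemidef.one, Matrix.one_mulVec]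
    simp [PiLp.inner_apply, dotProduct, mul_comm]
  · have hind : iIndepFun (fun i (x : Fin n → Euc d) => x i) (gaussianSample n μ) :=
      iIndepFun_pi (X := fun _ => id) fun _ => aemeasurable_id
    exact ((hind.indepFun h).comp (φ := fun y => inner ℝ a y) (ψ := fun y => inner ℝ b y)
      (by fun_prop) (by fun_prop)).covariance_eq_zero (memLp_inner_eval μ a i)
      (memLp_inner_eval μ b j)

lemma inner_sampleMean (a : Euc d) (x : Fin n → Euc d) :
    inner ℝ a (sampleMean x) = (n : ℝ)⁻¹ * ∑ i, inner ℝ a (x i) := by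
  rw [sampleMean, inner_smul_right, inner_sum]

lemma memLp_inner_sampleMean (μ a : Euc d) :
    MemLp (fun x : Fin n → Euc d => inner ℝ a (sampleMean x)) 2 (gaussianSample n μ) := by
  simp_rw [inner_sampleMean]
  exact (memLp_finsetSum _ fun i _ => memLp_inner_eval μ a i).const_mul _

lemma integral_inner_sampleMean (hn : n ≠ 0) (μ a : Euc d) :
    ∫ x : Fin n → Euc d, inner ℝ a (sampleMean x) ∂(gaussianSample n μ) = inner ℝ a μ := by
  simp_rw [inner_sampleMean]
  rw [integral_const_mul, integral_finsetSum _ fun i _ =>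
    (memLp_inner_eval μ a i).integrable (by norm_num)]
  simp_rw [integral_inner_eval]
  have : (n : ℝ) ≠ 0 := by exact_mod_cast hn
  simp only [Finset.sum_const, Finset.card_univ, Fintype.card_fin, nsmul_eq_mul]
  field_simp

lemma covariance_inner_eval_sampleMean (μ a b : Euc d) (i : Fin n) :
    cov[fun x : Fin n → Euc d => inner ℝ a (x i), fun x => inner ℝ b (sampleMean x);
      gaussianSample n μ] = (n : ℝ)⁻¹ * inner ℝ a b := by
  simp_rw [inner_sampleMean]
  rw [covariance_const_mul_right, covariance_fun_sum_right (fun j => memLp_inner_eval μ b j)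
    (memLp_inner_eval μ a i)]
  simp_rw [covariance_inner_eval]
  simp

lemma covariance_inner_sampleMean (hn : n ≠ 0) (μ a b : Euc d) :
    cov[fun x : Fin n → Euc d => inner ℝ a (sampleMean x), fun x => inner ℝ b (sampleMean x);
      gaussianSample n μ] = (n : ℝ)⁻¹ * inner ℝ a b := by
  have h : (fun x : Fin n → Euc d => inner ℝ a (sampleMean x)) =
      fun x => (n : ℝ)⁻¹ * ∑ i, inner ℝ a (x i) := funext fun x => inner_sampleMean a x
  rw [h, covariance_const_mul_left, covariance_fun_sum_left (fun j => memLp_inner_eval μ a j)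
    (memLp_inner_sampleMean μ b)]
  simp_rw [covariance_inner_eval_sampleMean]
  have : (n : ℝ) ≠ 0 := by exact_mod_cast hn
  simp only [Finset.sum_const, Finset.card_univ, Fintype.card_fin, nsmul_eq_mul]
  field_simp

/-- The sample mean as a continuous linear map. -/
def sampleMeanL (n d : ℕ) : (Fin n → Euc d) →L[ℝ] Euc d :=
  (n : ℝ)⁻¹ • ∑ i, ContinuousLinearMap.proj i

lemma sampleMeanL_apply (x : Fin n → Euc d) : sampleMeanL n d x = sampleMean x := by
  simp [sampleMeanL, sampleMean]

lemma norm_sampleMean_le (x : Fin n → Euc d) : ‖sampleMean x‖ ≤ ‖x‖ := by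
  rcases eq_or_ne n 0 with rfl | hn
  · simp [sampleMean]
  · have hn' : (n : ℝ) ≠ 0 := by exact_mod_cast hn
    rw [sampleMean, norm_smul, norm_inv, RCLike.norm_natCast]
    have h1 : ‖∑ i, x i‖ ≤ ∑ _i : Fin n, ‖x‖ := norm_sum_le_of_le _ fun i _ => norm_le_pi_norm x i
    simp at h1
    rw [inv_mul_le_iff₀ (by positivity)]
    exact h1

/-- The sample mean has law `N(μ, I / n)`. -/
lemma map_sampleMean (hn : n ≠ 0) (μ : Euc d) :
    (gaussianSample n μ).map sampleMean =
      (stdGaussian (Euc d)).map fun z => μ + (√(n : ℝ))⁻¹ • z := by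
  have hm : (sampleMean : (Fin n → Euc d) → Euc d) = sampleMeanL n d :=
    funext fun x => (sampleMeanL_apply x).symm
  set L : Euc d →L[ℝ] Euc d := (√(n : ℝ))⁻¹ • ContinuousLinearMap.id ℝ (Euc d) with hL
  have hmap : (stdGaussian (Euc d)).map (fun z => μ + (√(n : ℝ))⁻¹ • z) =
      ((stdGaussian (Euc d)).map L).map fun z => μ + z := by
    rw [Measure.map_map (by fun_prop) (by fun_prop)]
    rfl
  have hG1 : IsGaussian ((gaussianSample n μ).map sampleMean) := by rw [hm]; infer_instance
  have hG2 : IsGaussian (((stdGaussian (Euc d)).map L).map fun z => μ + z) := by infer_instance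
  rw [hmap]
  -- Gaussian measures are determined by mean and covariance.
  refine IsGaussian.ext ?_ ?_
  · refine ext_inner_left ℝ fun a => ?_
    rw [← integral_inner IsGaussian.integrable_id, ← integral_inner IsGaussian.integrable_id,
      integral_map (by fun_prop) (by fun_prop), ← hmap,
      integral_map (by fun_prop) (by fun_prop)]
    simp only [id]
    rw [integral_inner_sampleMean hn]
    have := integral_add_inner_stdGaussian (inner ℝ a μ) ((√(n : ℝ))⁻¹ • a)
    rw [← this]
    congr 1 with z
    rw [inner_add_right, inner_smul_right, real_inner_smul_left]
  · ext a b
    rw [covarianceBilin_apply_eq_cov IsGaussian.memLp_two_id,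
      covariance_map_fun (by fun_prop) (by fun_prop) (by fun_prop),
      covariance_inner_sampleMean hn, covarianceBilin_map_const_add,
      covarianceBilin_map IsGaussian.memLp_two_id, covarianceBilin_stdGaussian, hL]
    have hid : ContinuousLinearMap.adjoint (ContinuousLinearMap.id ℝ (Euc d)) =
        ContinuousLinearMap.id ℝ (Euc d) :=
      ((ContinuousLinearMap.eq_adjoint_iff _ _).2 fun _ _ => rfl).symm
    rw [map_smulₛₗ, hid]
    change _ = inner ℝ ((√(n : ℝ))⁻¹ • a) ((√(n : ℝ))⁻¹ • b)
    rw [real_inner_smul_left, inner_smul_right, ← mul_assoc, ← mul_inv, Real.mul_self_sqrt (Nat.cast_nonneg _)]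

lemma integral_comp_sampleMean (hn : n ≠ 0) (μ : Euc d) {f : Euc d → ℝ} (hf : Continuous f) :
    ∫ x, f (sampleMean x) ∂(gaussianSample n μ) =
      ∫ z, f (μ + (√(n : ℝ))⁻¹ • z) ∂(stdGaussian (Euc d)) := by
  rw [← integral_map (φ := sampleMean) (by fun_prop) hf.aestronglyMeasurable, map_sampleMean hn,
    integral_map (by fun_prop) hf.aestronglyMeasurable]

lemma integral_norm_add_smul_sampleMean_sq (hn : n ≠ 0) (μ a : Euc d) (c : ℝ) :
    ∫ x : Fin n → Euc d, ‖a + c • sampleMean x‖ ^ 2 ∂(gaussianSample n μ) =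
      ‖a + c • μ‖ ^ 2 + c ^ 2 * (d / n) := by
  rw [integral_comp_sampleMean hn μ (f := fun y => ‖a + c • y‖ ^ 2) (by fun_prop)]
  have := integral_norm_add_apply_sq (EuclideanSpace.basisFun (Fin d) ℝ) (a + c • μ)
    ((c * (√(n : ℝ))⁻¹) • ContinuousLinearMap.id ℝ (Euc d))
  have h2 : ∀ z : Euc d, a + c • (μ + (√(n : ℝ))⁻¹ • z) = a + c • μ +
      ((c * (√(n : ℝ))⁻¹) • ContinuousLinearMap.id ℝ (Euc d)) z := by
    intro z
    simp [smul_add, smul_smul, add_assoc]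
  simp_rw [h2, this]
  simp [norm_smul, mul_pow]
  ring

/-- The factors 8 come from (s+t)⁴ ≤ 8(s⁴+t⁴). The fourth moment is never evaluated, as only its
independence of d and n matters. -/
lemma integral_norm_sampleMean_pow_four_le (hn : n ≠ 0) (μ : Euc d) :
    ∫ x : Fin n → Euc d, ‖sampleMean x‖ ^ 4 ∂(gaussianSample n μ) ≤
      8 * (‖μ‖ ^ 2) ^ 2 + 8 * gaussianFourthMoment * (d / n) ^ 2 := by
  rw [integral_comp_sampleMean hn μ (f := fun y => ‖y‖ ^ 4) (by fun_prop)]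
  have hint : Integrable (fun z : Euc d => ‖z‖ ^ 4) (stdGaussian (Euc d)) := by
    refine integrable_of_abs_le_pow _ (Continuous.aestronglyMeasurable (by fun_prop)) 1 fun z => ?_
    rw [abs_of_nonneg (by positivity), one_mul]
    gcongr
    linarith
  have hc : ((√(n : ℝ))⁻¹) ^ 4 = ((n : ℝ)⁻¹) ^ 2 := by
    rw [show 4 = 2 * 2 from rfl, pow_mul, inv_pow, Real.sq_sqrt (Nat.cast_nonneg _)]
  have hpt : ∀ z : Euc d, ‖μ + (√(n : ℝ))⁻¹ • z‖ ^ 4 ≤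
      8 * (‖μ‖ ^ 2) ^ 2 + 8 * (((n : ℝ)⁻¹) ^ 2 * ‖z‖ ^ 4) := by
    intro z
    have h1 := norm_add_le μ ((√(n : ℝ))⁻¹ • z)
    have h2 : ‖(√(n : ℝ))⁻¹ • z‖ ^ 4 = ((n : ℝ)⁻¹) ^ 2 * ‖z‖ ^ 4 := by
      rw [norm_smul, mul_pow, Real.norm_eq_abs, Even.pow_abs (by decide), hc]
    rw [← h2]
    set s := ‖(√(n : ℝ))⁻¹ • z‖
    have h3 : ‖μ + (√(n : ℝ))⁻¹ • z‖ ^ 4 ≤ (‖μ‖ + s) ^ 4 := by gcongr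
    have h4 : (‖μ‖ + s) ^ 2 ≤ 2 * (‖μ‖ ^ 2 + s ^ 2) := add_sq_le
    have h5 : ((‖μ‖ + s) ^ 2) ^ 2 ≤ (2 * (‖μ‖ ^ 2 + s ^ 2)) ^ 2 := by gcongr
    nlinarith [sq_nonneg (‖μ‖ ^ 2 - s ^ 2)]
  calc _ ≤ ∫ z : Euc d, (8 * (‖μ‖ ^ 2) ^ 2 + 8 * (((n : ℝ)⁻¹) ^ 2 * ‖z‖ ^ 4))
        ∂(stdGaussian (Euc d)) := by
        refine integral_mono_of_nonneg (ae_of_all _ fun _ => by positivity)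
          ((integrable_const _).add ((hint.const_mul _).const_mul _)) (ae_of_all _ hpt)
    _ = 8 * (‖μ‖ ^ 2) ^ 2 + 8 * (((n : ℝ)⁻¹) ^ 2 * ∫ z : Euc d, ‖z‖ ^ 4
        ∂(stdGaussian (Euc d))) := by
        rw [integral_add (integrable_const _) ((hint.const_mul _).const_mul _),
          integral_const_mul _ fun z : Euc d => ((n : ℝ)⁻¹) ^ 2 * ‖z‖ ^ 4,
          integral_const_mul _ fun z : Euc d => ‖z‖ ^ 4, integral_const]
        simp
    _ ≤ 8 * (‖μ‖ ^ 2) ^ 2 + 8 * (((n : ℝ)⁻¹) ^ 2 * (d ^ 2 * gaussianFourthMoment)) := by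
        gcongr
        exact integral_norm_pow_four_le
    _ = _ := by ring

/-- Centred points are independent of the sample mean. -/
lemma indepFun_sub_sampleMean (hn : n ≠ 0) (μ : Euc d) (i : Fin n) :
    IndepFun (fun x : Fin n → Euc d => x i - sampleMean x) sampleMean (gaussianSample n μ) := by
  -- For jointly Gaussian vectors it suffices that they are uncorrelated: a point and the mean
  -- itself have the same covariance with the mean.
  refine HasGaussianLaw.indepFun_of_covariance_inner ?_ fun a b => ?_
  · have := (hasGaussianLaw_gaussianSample (n := n) μ).map_fun
      ((ContinuousLinearMap.proj i - sampleMeanL n d).prod (sampleMeanL n d))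
    simpa [sampleMeanL_apply] using this
  · simp_rw [inner_sub_right]
    rw [covariance_fun_sub_left (memLp_inner_eval μ a i) (memLp_inner_sampleMean μ a)
      (memLp_inner_sampleMean μ b), covariance_inner_eval_sampleMean,
      covariance_inner_sampleMean hn, sub_self]

/-- The projection is centred with variance (1 - 1/n)‖v‖². -/
lemma integral_inner_sub_sampleMean_sq_le (hn : n ≠ 0) (μ v : Euc d) (i : Fin n) :
    ∫ x : Fin n → Euc d, inner ℝ (x i - sampleMean x) v ^ 2 ∂(gaussianSample n μ) ≤ ‖v‖ ^ 2 := by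
  have h1 := memLp_inner_eval (n := n) μ v i
  have h2 := memLp_inner_sampleMean (n := n) μ v
  have h := variance_eq_sub (h1.sub h2)
  have hmean : ∫ x, ((fun x => inner ℝ v (x i)) - fun x =>
      inner ℝ v (sampleMean x) : (Fin n → Euc d) → ℝ) x ∂(gaussianSample n μ) = 0 := by
    simp only [Pi.sub_apply]
    rw [integral_sub (h1.integrable (by norm_num)) (h2.integrable (by norm_num)),
      integral_inner_eval, integral_inner_sampleMean hn, sub_self]
  rw [hmean, variance_sub h1 h2, covariance_inner_eval_sampleMean,
    ← covariance_self h1.aestronglyMeasurable.aemeasurable,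
    ← covariance_self h2.aestronglyMeasurable.aemeasurable, covariance_inner_eval, if_pos rfl,
    covariance_inner_sampleMean hn, real_inner_self_eq_norm_sq] at h
  have h3 : ∫ x : Fin n → Euc d, inner ℝ (x i - sampleMean x) v ^ 2 ∂(gaussianSample n μ) =
      ∫ x, (((fun x => inner ℝ v (x i)) - fun x =>
      inner ℝ v (sampleMean x) : (Fin n → Euc d) → ℝ) ^ 2) x ∂(gaussianSample n μ) := by
    congr 1 with x
    simp [real_inner_comm, inner_sub_left]
  rw [h3]
  have : 0 ≤ (n : ℝ)⁻¹ * ‖v‖ ^ 2 := by positivity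
  linarith

lemma integrable_inner_sub_sampleMean_sq (μ : Euc d) (i : Fin n) :
    Integrable (fun x : Fin n → Euc d => inner ℝ (x i - sampleMean x) (sampleMean x) ^ 2)
      (gaussianSample n μ) := by
  refine integrable_of_abs_le_pow _ (Continuous.aestronglyMeasurable (by fun_prop)) 4 fun x => ?_
  have h1 : ‖x i - sampleMean x‖ ≤ 2 * ‖x‖ := by
    linarith [norm_sub_le (x i) (sampleMean x), norm_le_pi_norm x i, norm_sampleMean_le x]
  have h2 : |inner ℝ (x i - sampleMean x) (sampleMean x)| ≤ 2 * ‖x‖ * ‖x‖ :=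
    (abs_real_inner_le_norm _ _).trans (mul_le_mul h1 (norm_sampleMean_le x)
      (norm_nonneg _) (by positivity))
  rw [abs_pow]
  calc _ ≤ (2 * ‖x‖ * ‖x‖) ^ 2 := by gcongr
    _ = 4 * ‖x‖ ^ 4 := by ring
    _ ≤ _ := by gcongr; linarith

lemma integrable_norm_sampleMean_pow_four (μ : Euc d) :
    Integrable (fun x : Fin n → Euc d => ‖sampleMean x‖ ^ 4) (gaussianSample n μ) := by
  refine integrable_of_abs_le_pow _ (Continuous.aestronglyMeasurable (by fun_prop)) 1 fun x => ?_
  rw [abs_of_nonneg (by positivity), one_mul]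
  gcongr
  linarith [norm_sampleMean_le x]

lemma memLp_sampleMean (μ : Euc d) :
    MemLp (sampleMean : (Fin n → Euc d) → Euc d) 2 (gaussianSample n μ) := by
  have := ((hasGaussianLaw_gaussianSample (n := n) μ).map_fun (sampleMeanL n d)).memLp_two
  simpa only [sampleMeanL_apply] using this

lemma integrable_norm_add_smul_sampleMean_sq (μ a : Euc d) (c : ℝ) :
    Integrable (fun x : Fin n → Euc d => ‖a + c • sampleMean x‖ ^ 2) (gaussianSample n μ) :=
  ((memLp_const a).add ((memLp_sampleMean μ).const_smul c)).integrable_norm_pow (by norm_num)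

/-- By independence the sample mean can be frozen as a fixed vector v while the centred point is
integrated out. -/
lemma integral_inner_sub_sampleMean_self_sq_le (hn : n ≠ 0) (μ : Euc d) (i : Fin n) :
    ∫ x : Fin n → Euc d, inner ℝ (x i - sampleMean x) (sampleMean x) ^ 2 ∂(gaussianSample n μ) ≤
      ∫ x : Fin n → Euc d, ‖sampleMean x‖ ^ 2 ∂(gaussianSample n μ) := by
  set P := gaussianSample n μ
  set Y : (Fin n → Euc d) → Euc d := fun x => x i - sampleMean x with hYdef
  have hY : Measurable Y := by fun_prop
  have hm : Measurable (sampleMean : (Fin n → Euc d) → Euc d) := by fun_prop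
  have hYP : IsProbabilityMeasure (P.map Y) := Measure.isProbabilityMeasure_map hY.aemeasurable
  have hmP : IsProbabilityMeasure (P.map sampleMean) :=
    Measure.isProbabilityMeasure_map hm.aemeasurable
  have hind := (indepFun_iff_map_prod_eq_prod_map_map hY.aemeasurable hm.aemeasurable).1
    (indepFun_sub_sampleMean hn μ i)
  have hf : Continuous fun p : Euc d × Euc d => inner ℝ p.1 p.2 ^ 2 := by fun_prop
  have hint : Integrable (fun p : Euc d × Euc d => inner ℝ p.1 p.2 ^ 2)
      ((P.map Y).prod (P.map sampleMean)) := by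
    rw [← hind, integrable_map_measure hf.aestronglyMeasurable (by fun_prop)]
    exact integrable_inner_sub_sampleMean_sq μ i
  have h1 : ∫ x, inner ℝ (Y x) (sampleMean x) ^ 2 ∂P =
      ∫ v, ∫ y, inner ℝ y v ^ 2 ∂(P.map Y) ∂(P.map sampleMean) := by
    rw [← integral_prod_symm _ hint, ← hind, integral_map (by fun_prop) hf.aestronglyMeasurable]
  have h2 : ∫ x, ‖sampleMean x‖ ^ 2 ∂P = ∫ v, ‖v‖ ^ 2 ∂(P.map sampleMean) := by
    rw [integral_map hm.aemeasurable (by fun_prop)]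
  rw [h1, h2]
  refine integral_mono hint.integral_prod_right ?_ fun v => ?_
  · rw [integrable_map_measure (by fun_prop) hm.aemeasurable]
    exact (memLp_sampleMean μ).integrable_norm_pow (by norm_num)
  · simp only
    rw [integral_map hY.aemeasurable (by fun_prop)]
    exact integral_inner_sub_sampleMean_sq_le hn μ v i

end Sample

/-! ### The expected gain -/

section Expectation

variable {n d : ℕ}

lemma aestronglyMeasurable_genErr (μ : Euc d) (ρ : ℝ) {T : ℝ} (hT : 0 < T) :
    AEStronglyMeasurable (genErr μ ρ T) (gaussianSample n μ) :=
  (measurable_genErr μ ρ hT).aestronglyMeasurable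

/-- An integrable bound for `genErr`, uniform in the length of the diffusion. -/
def genErrBound (μ : Euc d) (x : Fin n → Euc d) : ℝ :=
  2 * ‖μ‖ ^ 2 + 2 * ‖sampleMean x‖ ^ 2 + 2 * d + 4 * ((n : ℝ)⁻¹ * ∑ i, ‖x i‖ ^ 2)

lemma integrable_norm_sampleMean_sq (μ : Euc d) :
    Integrable (fun x : Fin n → Euc d => ‖sampleMean x‖ ^ 2) (gaussianSample n μ) :=
  (memLp_sampleMean μ).integrable_norm_pow (by norm_num)

lemma integrable_genErrBound (μ : Euc d) :
    Integrable (genErrBound (n := n) μ) (gaussianSample n μ) := by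
  have h : ∀ i, Integrable (fun x : Fin n → Euc d => ‖x i‖ ^ 2) (gaussianSample n μ) := fun i =>
    ((hasGaussianLaw_gaussianSample μ).eval i).memLp_two.integrable_norm_pow (by norm_num)
  exact (((integrable_const _).add ((integrable_norm_sampleMean_sq μ).const_mul 2)).add
    (integrable_const _)).add (((integrable_finsetSum _ fun i _ => h i).const_mul _).const_mul 4)

lemma integrable_genErr (hn : n ≠ 0) (μ : Euc d) {ρ T : ℝ} (hρ : 0 ≤ ρ) (hρ1 : ρ ≤ 1)
    (hT : 1 ≤ T) : Integrable (genErr μ ρ T) (gaussianSample n μ) := by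
  refine (integrable_genErrBound μ).mono' (aestronglyMeasurable_genErr μ ρ (by linarith))
    (ae_of_all _ fun x => ?_)
  rw [Real.norm_eq_abs, abs_of_nonneg (genErr_nonneg _ _ _ _)]
  exact genErr_le hn μ hρ hρ1 hT x

lemma integrable_genErrLim (hn : n ≠ 0) (μ : Euc d) {ρ : ℝ} (hρ : 0 ≤ ρ) (hρ1 : ρ ≤ 1) :
    Integrable (genErrLim μ ρ) (gaussianSample n μ) := by
  have hle : ∀ x : Fin n → Euc d, genErrLim μ ρ x ≤ genErrBound μ x := fun x =>
    le_of_tendsto (tendsto_genErr μ ρ x) <| by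
      filter_upwards [eventually_ge_atTop 1] with T hT using genErr_le hn μ hρ hρ1 hT x
  refine (integrable_genErrBound μ).mono' ?_ (ae_of_all _ fun x => ?_)
  · have hshift : Tendsto (fun N : ℕ => (N : ℝ) + 1) atTop atTop :=
      tendsto_atTop_add_const_right _ _ tendsto_natCast_atTop_atTop
    -- A countable sequence of lengths, shifted by one so that all are positive.
    exact (measurable_of_tendsto_metrizable
      (f := fun N : ℕ => genErr μ ρ ((N : ℝ) + 1)) (fun N => measurable_genErr μ ρ (by positivity))
      (tendsto_pi_nhds.2 fun x => (tendsto_genErr μ ρ x).comp hshift)).aestronglyMeasurable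
  · rw [Real.norm_eq_abs, abs_of_nonneg (by unfold genErrLim; positivity)]
    exact hle x

lemma tendsto_integral_genErr (hn : n ≠ 0) (μ : Euc d) {ρ : ℝ} (hρ : 0 ≤ ρ) (hρ1 : ρ ≤ 1) :
    Tendsto (fun T => ∫ x, genErr μ ρ T x ∂(gaussianSample n μ)) atTop
      (nhds (∫ x, genErrLim μ ρ x ∂(gaussianSample n μ))) := by
  refine tendsto_integral_filter_of_dominated_convergence (genErrBound μ) ?_ ?_
    (integrable_genErrBound μ) (ae_of_all _ fun x => tendsto_genErr μ ρ x)
  · filter_upwards [eventually_ge_atTop 1] with T hT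
      using aestronglyMeasurable_genErr μ ρ (by linarith)
  · filter_upwards [eventually_ge_atTop 1] with T hT
    refine ae_of_all _ fun x => ?_
    rw [Real.norm_eq_abs, abs_of_nonneg (genErr_nonneg _ _ _ _)]
    exact genErr_le hn μ hρ hρ1 hT x

/-- The part of the gain that comes from the mean and the trace of the covariance. -/
def meanGain (μ : Euc d) (ρ : ℝ) (x : Fin n → Euc d) : ℝ :=
  ‖μ - sampleMean x‖ ^ 2 - ‖μ - (1 - ρ) • sampleMean x‖ ^ 2 - ρ * ‖sampleMean x‖ ^ 2

lemma integrable_norm_sub_smul_sampleMean_sq (μ : Euc d) (c : ℝ) :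
    Integrable (fun x : Fin n → Euc d => ‖μ - c • sampleMean x‖ ^ 2) (gaussianSample n μ) := by
  simpa only [neg_smul, ← sub_eq_add_neg] using
    integrable_norm_add_smul_sampleMean_sq (n := n) μ μ (-c)

lemma integral_norm_sub_smul_sampleMean_sq (hn : n ≠ 0) (μ : Euc d) (c : ℝ) :
    ∫ x : Fin n → Euc d, ‖μ - c • sampleMean x‖ ^ 2 ∂(gaussianSample n μ) =
      (1 - c) ^ 2 * ‖μ‖ ^ 2 + c ^ 2 * (d / n) := by
  have h := integral_norm_add_smul_sampleMean_sq hn μ μ (-c)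
  simp only [neg_smul, ← sub_eq_add_neg] at h
  have h2 : μ - c • μ = (1 - c) • μ := by rw [sub_smul, one_smul]
  rw [h, h2, norm_smul, mul_pow, Real.norm_eq_abs, sq_abs, neg_sq]

lemma integral_norm_sampleMean_sq (hn : n ≠ 0) (μ : Euc d) :
    ∫ x : Fin n → Euc d, ‖sampleMean x‖ ^ 2 ∂(gaussianSample n μ) = ‖μ‖ ^ 2 + d / n := by
  have h := integral_norm_add_smul_sampleMean_sq hn μ 0 1
  simpa using h

lemma integrable_meanGain (μ : Euc d) (ρ : ℝ) :
    Integrable (meanGain (n := n) μ ρ) (gaussianSample n μ) := by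
  have h1 := integrable_norm_sub_smul_sampleMean_sq (n := n) μ 1
  simp only [one_smul] at h1
  exact (h1.sub (integrable_norm_sub_smul_sampleMean_sq μ (1 - ρ))).sub
    ((integrable_norm_sampleMean_sq μ).const_mul ρ)

/-- Bias and variance of the shrunken mean cost ρ²‖μ‖² and gain (2ρ - ρ²)d/n; the first-order loss
-ρ‖μ‖² comes from the trace of the covariance. -/
lemma integral_meanGain (hn : n ≠ 0) (μ : Euc d) (ρ : ℝ) :
    ∫ x, meanGain μ ρ x ∂(gaussianSample n μ) =
      d / n * (ρ * (1 - ρ)) - ρ * (1 + ρ) * ‖μ‖ ^ 2 := by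
  have h1 := integrable_norm_sub_smul_sampleMean_sq (n := n) μ 1
  have e1 := integral_norm_sub_smul_sampleMean_sq hn μ 1
  simp only [one_smul] at h1 e1
  have h2 : Integrable (fun x : Fin n → Euc d =>
      ‖μ - sampleMean x‖ ^ 2 - ‖μ - (1 - ρ) • sampleMean x‖ ^ 2) (gaussianSample n μ) :=
    h1.sub (integrable_norm_sub_smul_sampleMean_sq μ (1 - ρ))
  unfold meanGain
  rw [integral_sub h2 ((integrable_norm_sampleMean_sq μ).const_mul ρ),
    integral_sub h1 (integrable_norm_sub_smul_sampleMean_sq μ (1 - ρ)), integral_const_mul, e1,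
    integral_norm_sub_smul_sampleMean_sq hn, integral_norm_sampleMean_sq hn]
  ring

/-- The lower bound of `le_sqrtGain`. -/
def sqrtGainBound (ρ : ℝ) (x : Fin n → Euc d) : ℝ :=
  ρ / 4 * (3 * ‖sampleMean x‖ ^ 2 -
      (n : ℝ)⁻¹ * ∑ i, inner ℝ (x i - sampleMean x) (sampleMean x) ^ 2 -
      ρ * ‖sampleMean x‖ ^ 4)

lemma integrable_sqrtGainBound (μ : Euc d) (ρ : ℝ) :
    Integrable (sqrtGainBound (n := n) ρ) (gaussianSample n μ) :=
  ((((integrable_norm_sampleMean_sq μ).const_mul 3).sub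
    ((integrable_finsetSum _ fun i _ => integrable_inner_sub_sampleMean_sq μ i).const_mul _)).sub
    ((integrable_norm_sampleMean_pow_four μ).const_mul ρ)).const_mul _

/-- The coefficient 2 is 3 - 1: the centred quadratic form costs at most one copy of E‖m‖² = ‖μ‖² +
d/n. -/
lemma le_integral_sqrtGainBound (hn : n ≠ 0) (μ : Euc d) {ρ : ℝ} (hρ : 0 ≤ ρ) :
    ρ / 4 * (2 * (‖μ‖ ^ 2 + d / n) -
      ρ * (8 * (‖μ‖ ^ 2) ^ 2 + 8 * gaussianFourthMoment * (d / n) ^ 2)) ≤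
      ∫ x, sqrtGainBound ρ x ∂(gaussianSample n μ) := by
  have i1 := (integrable_norm_sampleMean_sq (n := n) μ).const_mul 3
  have i2 := (integrable_finsetSum Finset.univ fun i _ =>
    integrable_inner_sub_sampleMean_sq (n := n) μ i).const_mul (n : ℝ)⁻¹
  have i3 := (integrable_norm_sampleMean_pow_four (n := n) μ).const_mul ρ
  have h4 := integral_norm_sampleMean_pow_four_le hn μ
  have h2 : (n : ℝ)⁻¹ * ∑ i, ∫ x : Fin n → Euc d,
      inner ℝ (x i - sampleMean x) (sampleMean x) ^ 2 ∂(gaussianSample n μ) ≤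
      ‖μ‖ ^ 2 + d / n := by
    have h := Finset.sum_le_sum fun i (_ : i ∈ Finset.univ) =>
      integral_inner_sub_sampleMean_self_sq_le hn μ i
    have hn' : (0 : ℝ) < n := by exact_mod_cast Nat.pos_of_ne_zero hn
    rw [inv_mul_le_iff₀ hn']
    rw [integral_norm_sampleMean_sq hn] at h
    simpa only [Finset.sum_const, Finset.card_univ, Fintype.card_fin, nsmul_eq_mul] using h
  have i12 : Integrable (fun x : Fin n → Euc d => 3 * ‖sampleMean x‖ ^ 2 -
      (n : ℝ)⁻¹ * ∑ i, inner ℝ (x i - sampleMean x) (sampleMean x) ^ 2) (gaussianSample n μ) :=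
    i1.sub i2
  unfold sqrtGainBound
  rw [integral_const_mul, integral_sub i12 i3, integral_sub i1 i2, integral_const_mul,
    integral_const_mul (n : ℝ)⁻¹, integral_const_mul ρ,
    integral_finsetSum _ fun i _ => integrable_inner_sub_sampleMean_sq μ i,
    integral_norm_sampleMean_sq hn]
  have h5 := mul_le_mul_of_nonneg_left h4 hρ
  exact mul_le_mul_of_nonneg_left (by linarith) (by linarith)

/-- The trace gain is dropped here: its lower bound contains (d/n)², which is useless for large d/n.
-/
lemma le_integral_genErrLim_sub (hn : n ≠ 0) (μ : Euc d) {ρ : ℝ} (hρ : 0 ≤ ρ) (hρ1 : ρ ≤ 1) :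
    d / n * (ρ * (1 - ρ)) - ρ * (1 + ρ) * ‖μ‖ ^ 2 ≤
      ∫ x, (genErrLim μ 0 x - genErrLim μ ρ x) ∂(gaussianSample n μ) := by
  rw [← integral_meanGain hn]
  refine integral_mono (integrable_meanGain μ ρ) ((integrable_genErrLim hn μ le_rfl
    zero_le_one).sub (integrable_genErrLim hn μ hρ hρ1)) fun x => ?_
  simp only
  rw [genErrLim_zero_sub hn μ hρ, meanGain]
  linarith [sqrtGain_nonneg hn hρ x]

lemma le_integral_genErrLim_sub' (hn : n ≠ 0) (μ : Euc d) {ρ : ℝ} (hρ : 0 ≤ ρ) (hρ1 : ρ ≤ 1) :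
    d / n * (ρ * (1 - ρ)) - ρ * (1 + ρ) * ‖μ‖ ^ 2 +
      2 * (ρ / 4 * (2 * (‖μ‖ ^ 2 + d / n) -
      ρ * (8 * (‖μ‖ ^ 2) ^ 2 + 8 * gaussianFourthMoment * (d / n) ^ 2))) ≤
      ∫ x, (genErrLim μ 0 x - genErrLim μ ρ x) ∂(gaussianSample n μ) := by
  have h1 : ∫ x : Fin n → Euc d, (meanGain μ ρ x + 2 * sqrtGainBound ρ x) ∂(gaussianSample n μ) ≤
      ∫ x, (genErrLim μ 0 x - genErrLim μ ρ x) ∂(gaussianSample n μ) := by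
    refine integral_mono ((integrable_meanGain μ ρ).add
      ((integrable_sqrtGainBound μ ρ).const_mul 2)) ((integrable_genErrLim hn μ le_rfl
      zero_le_one).sub (integrable_genErrLim hn μ hρ hρ1)) fun x => ?_
    simp only
    rw [genErrLim_zero_sub hn μ hρ, meanGain]
    have := le_sqrtGain hn hρ x
    rw [← sqrtGainBound] at this
    linarith
  rw [integral_add (integrable_meanGain μ ρ) ((integrable_sqrtGainBound μ ρ).const_mul 2),
    integral_const_mul, integral_meanGain hn] at h1
  linarith [le_integral_sqrtGainBound hn μ hρ]

/-- The real inequality behind the comparison. -/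
lemma gain_lower_bound {B M b q ρ C c : ℝ} (hM : 0 ≤ M) (hb : 0 ≤ b) (hbB : b ≤ B)
    (hC : C = 1 + B + 4 * B ^ 2 + 64 * M * B ^ 2) (hq : 0 ≤ q) (hρ : 0 ≤ ρ) (hc : 0 ≤ c)
    (hcC : c * C ≤ 1 / 4) (hρc : ρ ≤ c) (hρq : ρ ≤ c * q) {I : ℝ}
    (h1 : q * (ρ * (1 - ρ)) - ρ * (1 + ρ) * b ≤ I)
    (h2 : q * (ρ * (1 - ρ)) - ρ * (1 + ρ) * b +
      2 * (ρ / 4 * (2 * (b + q) - ρ * (8 * b ^ 2 + 8 * M * q ^ 2))) ≤ I) :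
    7 / 16 * (ρ * q) ≤ I := by
  have hB : 0 ≤ B := hb.trans hbB
  have hMB : 0 ≤ M * B ^ 2 := by positivity
  have hC1 : 1 ≤ C := by rw [hC]; nlinarith [sq_nonneg B]
  have hc4 : c ≤ 1 / 4 := by nlinarith
  -- For q ≥ 4B the mean gain dominates, with 3/4 - 5/16 = 7/16. For q ≤ 4B the terms ±ρb cancel in
  -- `h2`, and the ρ² terms are absorbed by the smallness of ρ.
  rcases le_total (4 * B) q with h | h
  · refine le_trans ?_ h1
    have h3 : ρ * ((1 + ρ) * b) ≤ ρ * ((1 + ρ) * (q / 4)) := by gcongr; linarith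
    have h4 : ρ * q * ρ ≤ ρ * q * (1 / 4) := by gcongr; linarith
    nlinarith
  · refine le_trans ?_ h2
    -- This fixes the constant: 4Mq² ≤ 64MB² because q ≤ 4B.
    have h3 : b + (4 * b ^ 2 + 4 * M * q ^ 2) ≤ C := by
      have e1 : b ^ 2 ≤ B ^ 2 := by gcongr
      have e2 : M * q ^ 2 ≤ M * (4 * B) ^ 2 := by gcongr
      rw [hC]; nlinarith
    have h4 : ρ * (b + (4 * b ^ 2 + 4 * M * q ^ 2)) ≤ q * (1 / 4) := by
      calc _ ≤ c * q * C := by gcongr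
        _ = q * (c * C) := by ring
        _ ≤ _ := by gcongr
    have h5 : ρ * (ρ * (b + (4 * b ^ 2 + 4 * M * q ^ 2))) ≤ ρ * (q * (1 / 4)) := by gcongr
    have h6 : ρ * q * ρ ≤ ρ * q * (1 / 4) := by gcongr; linarith
    have h7 : 0 ≤ ρ * q := by positivity
    nlinarith

end Expectation

/-! ### Choice of constants and conclusion -/

/-- The constant of `gain_lower_bound`. -/
def gainConst (B : ℝ) : ℝ := 1 + |B| + 4 * |B| ^ 2 + 64 * gaussianFourthMoment * |B| ^ 2

lemma one_le_gainConst (B : ℝ) : 1 ≤ gainConst B := by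
  have := gaussianFourthMoment_nonneg
  have h : 0 ≤ |B| + 4 * |B| ^ 2 + 64 * gaussianFourthMoment * |B| ^ 2 := by positivity
  unfold gainConst
  linarith

lemma integral_genErrLim_gt {n d : ℕ} (hn : n ≠ 0) (hd : d ≠ 0) {B : ℝ} (μ : Euc d)
    (hμ : ‖μ‖ ^ 2 ≤ B) {γ : ℝ} (hγ : 0 < γ) (hγn : γ ^ 2 ≤ (1 / (2 * gainConst B)) ^ 2 / n) :
    1 / 4 * (γ ^ 2 * d / n) <
      ∫ x, (genErrLim μ 0 x - genErrLim μ (shrinkage γ) x) ∂(gaussianSample n μ) := by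
  have hC := one_le_gainConst B
  have hn1 : (1 : ℝ) ≤ n := by exact_mod_cast Nat.one_le_iff_ne_zero.2 hn
  have hd1 : (1 : ℝ) ≤ d := by exact_mod_cast Nat.one_le_iff_ne_zero.2 hd
  set c := (1 / (2 * gainConst B)) ^ 2 with hc
  have hc0 : 0 ≤ c := by positivity
  have hcC : c * gainConst B ≤ 1 / 4 := by
    have : c * gainConst B = 1 / (4 * gainConst B) := by rw [hc]; field_simp; norm_num
    rw [this]
    exact one_div_le_one_div_of_le (by norm_num) (by linarith)
  have hc4 : c ≤ 1 / 4 := by nlinarith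
  have hcn : c / n ≤ c := div_le_self hc0 hn1
  have hγ0 : 0 < γ ^ 2 := by positivity
  have hργ : shrinkage γ ≤ γ ^ 2 := div_le_self hγ0.le (by linarith)
  have hγρ : 4 / 5 * γ ^ 2 ≤ shrinkage γ := by
    unfold shrinkage
    rw [le_div_iff₀ (by positivity)]
    nlinarith
  have hq : 0 < (d : ℝ) / n := by positivity
  -- The dimension is at least 1, so c/n ≤ c·d/n.
  have hρq : shrinkage γ ≤ c * (d / n) := by
    refine hργ.trans (hγn.trans ?_)
    rw [← mul_div_assoc]
    gcongr
    nlinarith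
  have hρ := shrinkage_nonneg γ
  have hρ1 : shrinkage γ ≤ 1 := by linarith
  have h := gain_lower_bound gaussianFourthMoment_nonneg (sq_nonneg ‖μ‖)
    (hμ.trans (le_abs_self B)) rfl hq.le hρ hc0 hcC (by linarith) hρq
    (le_integral_genErrLim_sub hn μ hρ hρ1) (le_integral_genErrLim_sub' hn μ hρ hρ1)
  -- 7/16 · 4/5 = 7/20 exceeds 1/4; the slack makes the inequality strict.
  refine lt_of_lt_of_le ?_ h
  have h1 : 4 / 5 * γ ^ 2 * (d / n) ≤ shrinkage γ * (d / n) := by gcongr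
  have h2 : 0 < γ ^ 2 * (d / n) := by positivity
  rw [mul_div_assoc]
  linarith

/-- A strict inequality between limits persists for large T. For γ = 0 or d = 0 strictness fails,
but both sides vanish. -/
lemma eventually_le_integral_genErr_sub {n d : ℕ} (hn : n ≠ 0) {B : ℝ} (μ : Euc d)
    (hμ : ‖μ‖ ^ 2 ≤ B) {γ : ℝ} (hγ : 0 ≤ γ) (hγn : γ ^ 2 ≤ (1 / (2 * gainConst B)) ^ 2 / n) :
    ∀ᶠ T in atTop, 1 / 4 * (γ ^ 2 * d / n) ≤
      ∫ x, (genErr μ 0 T x - genErr μ (shrinkage γ) T x) ∂(gaussianSample n μ) := by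
  rcases hγ.eq_or_lt with rfl | hγ
  · simp [shrinkage_zero]
  rcases eq_or_ne d 0 with rfl | hd
  · have h : ∀ (ρ T : ℝ) (x : Fin n → Euc 0), genErr μ ρ T x = 0 := by
      intro ρ T x
      rw [genErr, Subsingleton.elim (μ - genMean ρ T x) 0]
      simp
    simp [h]
  have hρ := shrinkage_nonneg γ
  have hρ1 : shrinkage γ ≤ 1 := div_le_one_of_le₀ (by linarith) (by positivity)
  have hgt := integral_genErrLim_gt hn hd μ hμ hγ hγn
  rw [integral_sub (integrable_genErrLim hn μ le_rfl zero_le_one)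
    (integrable_genErrLim hn μ hρ hρ1)] at hgt
  filter_upwards [((tendsto_integral_genErr hn μ le_rfl zero_le_one).sub
    (tendsto_integral_genErr hn μ hρ hρ1)).eventually_const_lt hgt, eventually_ge_atTop 1]
    with T h hT
  rw [integral_sub (integrable_genErr hn μ le_rfl zero_le_one hT)
    (integrable_genErr hn μ hρ hρ1 hT)]
  exact h.le

lemma measurePreserving_eval_sampleLaw {K d : ℕ} (G : GaussianMixture K d) (n : Fin K → ℕ)
    (k : Fin K) :
    MeasurePreserving (fun X : Dataset n d => X k) (G.sampleLaw n)
      (gaussianSample (n k) (G.μ k)) := by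
  have (k : Fin K) : IsProbabilityMeasure (G.classLaw k) := by
    unfold GaussianMixture.classLaw; infer_instance
  exact measurePreserving_eval (fun k => Measure.pi fun _ : Fin (n k) => G.classLaw k) k

end

theorem theorem2 (B : ℝ) :
    ∃ c₀ : ℝ, 0 < c₀ ∧ ∃ κ : ℝ, 0 < κ ∧
      ∀ (K d : ℕ) (G : GaussianMixture K d) (n : Fin K → ℕ) (k : Fin K) (γ : ℝ),
        ‖G.μ k‖ ^ 2 ≤ B → 1 ≤ n k → 0 ≤ γ →
        γ ≤ c₀ / Real.sqrt ((Finset.univ.sup n : ℕ) : ℝ) →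
        ∀ᶠ T : ℝ in atTop,
          ∃ Q Qc : Dataset n d → Measure (Euc d),
            (∀ X Q', IsGenerationLaw G.w X 0 k T Q' ↔ Q' = Q X) ∧
            (∀ X Q', IsGenerationLaw G.w X γ k T Q' ↔ Q' = Qc X) ∧
            (∀ X, wasserstein2 (G.classLaw k) (Q X) ≠ ∞) ∧
            (∀ X, wasserstein2 (G.classLaw k) (Qc X) ≠ ∞) ∧
            Integrable (fun X => (wasserstein2 (G.classLaw k) (Q X)).toReal ^ 2)
              (G.sampleLaw n) ∧
            Integrable (fun X => (wasserstein2 (G.classLaw k) (Qc X)).toReal ^ 2)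
              (G.sampleLaw n) ∧
            κ * (γ ^ 2 * d / n k) ≤
              ∫ X, ((wasserstein2 (G.classLaw k) (Q X)).toReal ^ 2 -
                (wasserstein2 (G.classLaw k) (Qc X)).toReal ^ 2) ∂(G.sampleLaw n) := by
  have hC := one_le_gainConst B
  refine ⟨1 / (2 * gainConst B), by positivity, 1 / 4, by norm_num, ?_⟩
  intro K d G n k γ hμ hnk hγ hγle
  have hn : n k ≠ 0 := by omega
  -- Only the size of class k matters; the maximum over all classes is at least that.
  have hγn : γ ^ 2 ≤ (1 / (2 * gainConst B)) ^ 2 / n k := by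
    have hsup : (n k : ℝ) ≤ ((Finset.univ.sup n : ℕ) : ℝ) := by
      exact_mod_cast Finset.le_sup (Finset.mem_univ k)
    have hpos : (0 : ℝ) < n k := by exact_mod_cast hnk
    calc γ ^ 2 ≤ (1 / (2 * gainConst B) / √((Finset.univ.sup n : ℕ) : ℝ)) ^ 2 := by gcongr
      _ = (1 / (2 * gainConst B)) ^ 2 / ((Finset.univ.sup n : ℕ) : ℝ) := by
        rw [div_pow, Real.sq_sqrt (Nat.cast_nonneg _)]
      _ ≤ _ := by gcongr
  have hρ := shrinkage_nonneg γ
  have hρ1 : shrinkage γ ≤ 1 := div_le_one_of_le₀ (by linarith) (by positivity)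
  have hmp := measurePreserving_eval_sampleLaw G n k
  filter_upwards [eventually_le_integral_genErr_sub hn (G.μ k) hμ hγ hγn, eventually_ge_atTop 1]
    with T hle hT
  have hT0 : 0 < T := by linarith
  refine ⟨fun X => (stdGaussian (Euc d)).map (genMap 0 T (X k)),
    fun X => (stdGaussian (Euc d)).map (genMap (shrinkage γ) T (X k)), fun X Q' => ?_,
    fun X Q' => isGenerationLaw_iff G.w_pos X γ k hn hT0 Q',
    fun X => wasserstein2_genMap_ne_top _ _ _ _, fun X => wasserstein2_genMap_ne_top _ _ _ _, ?_⟩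
  · have := isGenerationLaw_iff G.w_pos X 0 k hn hT0 Q'
    rwa [shrinkage_zero] at this
  simp only [GaussianMixture.classLaw, toReal_wasserstein2_genMap_sq]
  refine ⟨hmp.integrable_comp_of_integrable (integrable_genErr hn (G.μ k) le_rfl zero_le_one hT),
    hmp.integrable_comp_of_integrable (integrable_genErr hn (G.μ k) hρ hρ1 hT), ?_⟩
  refine hle.trans_eq ?_
  have hm : AEStronglyMeasurable
      (fun x => genErr (G.μ k) 0 T x - genErr (G.μ k) (shrinkage γ) T x)
      (gaussianSample (n k) (G.μ k)) :=
    (aestronglyMeasurable_genErr _ _ hT0).sub (aestronglyMeasurable_genErr _ _ hT0)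
  rw [← hmp.map_eq] at hm ⊢
  rw [integral_map hmp.measurable.aemeasurable hm]
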